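/- Let $n\ge 3$, let $\mathbb S^n\subset\mathbb R^{n+1}$ be the round unit sphere, $\mathbf n=(0,\dots,0,1)$, $\mathbf s=(0,\dots,0,-1)$, and let $\mathcal L_{\mathbb S^n}=\Delta_{\mathbb S^n}-\frac{n(n-2)}{4}$ be the conformal Laplacian, where $\Delta_{\mathbb S^n}$ is the Laplace–Beltrami operator. Let $g:(\mathbb S^n\setminus\{\mathbf n\})\times(0,\infty)\to\mathbb R$ be continuous, with $g(\cdot,s)$ bounded from below on $\mathbb S^n\setminus\{\mathbf n\}$ for each $s\in(0,\infty)$, and suppose that (g1) for each $s>0$ the function $\theta\mapsto g(\theta,s)$ is rotationally symmetric about the line through $\mathbf n$ and $\mathbf s$; (g2) for each $s>0$ and any $\theta,\theta'\in\mathbb S^n\setminus\{\mathbf n\}$ on the same geodesic passing through $\mathbf n$ and $\mathbf s$, $g(\theta,s)>g(\theta',s)$ if $\theta_{n+1}>\theta'_{n+1}$; (g3) for each $\theta\in\mathbb S^n\setminus\{\mathbf n,\mathbf s\}$ the function $s\mapsto s^{-\frac{n+2}{n-2}}g(\theta,s)$ is non-increasing on $(0,\infty)$; (g4) for each $\theta\in\mathbb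 S^n\setminus\{\mathbf n,\mathbf s\}$ the function $s\mapsto g(\theta,s)$ is non-decreasing on $(0,\infty)$. If $v\in C^2(\mathbb S^n\setminus\{\mathbf n\})$ satisfies $$-\mathcal L_{\mathbb S^n}v=g(\theta,v)\quad\text{and}\quad v>0\qquad\text{on }\mathbb S^n\setminus\{\mathbf n\},$$ and $\liminf_{\theta\to\mathbf n}v(\theta)>0$, then $v$ is rotationally symmetric about the line through $\mathbf n$ and $\mathbf s$. -/

import Mathlib

open Set Filter Topology
open scoped Manifold Laplacian

noncomputable section

namespace SphereSymmetry

/-- The unit sphere of `ℝ^(n+1)` with its Euclidean norm. -/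
abbrev Sph (n : ℕ) : Type := Metric.sphere (0 : EuclideanSpace ℝ (Fin (n + 1))) 1

/-- The height of a point of the sphere, that is, its last coordinate. -/
def height {n : ℕ} (θ : Sph n) : ℝ := (θ : EuclideanSpace ℝ (Fin (n + 1))) (Fin.last n)

/-- The north pole `(0, …, 0, 1)`. -/
def north (n : ℕ) : Sph n := ⟨EuclideanSpace.single (Fin.last n) 1, by simp⟩

/-- The south pole `(0, …, 0, -1)`. -/
def south (n : ℕ) : Sph n := -north n

/-- The extension of a function on the sphere to `ℝ^(n+1) \ {0}` that is constant along rays,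
`x ↦ f (x / |x|)` (and `0` at the origin). -/
def radialExtension {n : ℕ} (f : Sph n → ℝ) (x : EuclideanSpace ℝ (Fin (n + 1))) : ℝ :=
  open Classical in
  if h : x ≠ 0 then
    f ⟨‖x‖⁻¹ • x, by
      rw [mem_sphere_zero_iff_norm, norm_smul, norm_inv, norm_norm,
        inv_mul_cancel₀ (norm_ne_zero_iff.mpr h)]⟩
  else 0

/-- The Laplace–Beltrami operator of the round unit sphere: the Euclidean Laplacian, taken at the
points of the sphere, of the extension that is constant along rays. In polar coordinates
`Δ = ∂ᵣ² + (n / r) ∂ᵣ + r⁻² Δ_S`, and the two radial terms vanish on such an extension. -/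
def sphereLaplacian {n : ℕ} (f : Sph n → ℝ) (θ : Sph n) : ℝ :=
  (Δ (radialExtension f)) (θ : EuclideanSpace ℝ (Fin (n + 1)))

/-- The conformal Laplacian `Δ_S - n (n - 2) / 4`. -/
def conformalLaplacian {n : ℕ} (f : Sph n → ℝ) (θ : Sph n) : ℝ :=
  sphereLaplacian f θ - (n : ℝ) * ((n : ℝ) - 2) / 4 * f θ

/-- The action of a linear isometry of `ℝ^(n+1)` on the sphere. -/
def isometryAct {n : ℕ}
    (R : EuclideanSpace ℝ (Fin (n + 1)) ≃ₗᵢ[ℝ] EuclideanSpace ℝ (Fin (n + 1)))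
    (θ : Sph n) : Sph n :=
  ⟨R θ, by rw [mem_sphere_zero_iff_norm, R.norm_map]; exact mem_sphere_zero_iff_norm.mp θ.2⟩

/-- Rotational symmetry, on the sphere without the north pole, about the line through the poles:
invariance under every linear isometry of `ℝ^(n+1)` that fixes this line pointwise. (When `n ≥ 2`
such isometries of determinant one have the same orbits, so restricting to them makes no
difference.) -/
def RotationallySymmetric {n : ℕ} (f : Sph n → ℝ) : Prop :=
  ∀ R : EuclideanSpace ℝ (Fin (n + 1)) ≃ₗᵢ[ℝ] EuclideanSpace ℝ (Fin (n + 1)),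
    isometryAct R (north n) = north n →
      ∀ θ : Sph n, θ ≠ north n → f (isometryAct R θ) = f θ

/-- `θ` and `θ'` lie on one geodesic (great circle) through the two poles. Such a geodesic is
`t ↦ cos t • north + sin t • e` for a unit vector `e` orthogonal to the axis. -/
def OnCommonPolarGeodesic {n : ℕ} (θ θ' : Sph n) : Prop :=
  ∃ e : Sph n, height e = 0 ∧ ∃ t t' : ℝ,
    (θ : EuclideanSpace ℝ (Fin (n + 1))) =
        Real.cos t • (north n : EuclideanSpace ℝ (Fin (n + 1))) +
          Real.sin t • (e : EuclideanSpace ℝ (Fin (n + 1))) ∧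
    (θ' : EuclideanSpace ℝ (Fin (n + 1))) =
        Real.cos t' • (north n : EuclideanSpace ℝ (Fin (n + 1))) +
          Real.sin t' • (e : EuclideanSpace ℝ (Fin (n + 1)))

end SphereSymmetry

end

open Set Filter Topology
open scoped Manifold Laplacian

noncomputable section

namespace SphereSymmetry

/-! ### Second-order calculus in Euclidean space -/

section Calculus

variable {ι : Type*} [Fintype ι] [DecidableEq ι]

/-! The proof moves spheres in stereographic coordinates from the north pole. Write `α = weight n =
-(n-2)/2` and extend `v` to a function `V` on the cone, homogeneous of degree `α`; then `ΔV` on the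
sphere is the conformal Laplacian of `v`. The function `U = V ∘ stereo` on `ℝ^n` is the conformal
transplant of `v`, and it has to be shown radial.

For a unit vector `e` and `τ > 0`, invert in the sphere through the origin with centre `τ⁻¹ • e`. By
homogeneity the Kelvin transform of `U` is `V ∘ stereoInv`. Both `stereo` and `stereoInv` are
quadratic, and `laplacian_comp_quadratic` gives `Δ(V ∘ q) = (ΔV) ∘ q` for them, so the equation is
only ever used on the cone. The image of an exterior point is nearer to the origin, hence lies lower
on the sphere. With (g1)-(g4), `laplacian_confExtension_lt` makes the difference of `U` and its
Kelvin transform strictly superharmonic wherever it is nonnegative.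

For large `τ` the spheres are tiny and `U` dominates its Kelvin transform outside them
(`eventually_atTop_dominates`); the liminf condition controls infinity. Domination is closed under
limits from the right, and open in `τ` (`eventually_dominates`): Hopf-type barriers from
`exists_lower_bound` prevent it from failing at the sphere or at infinity. So it holds for all `τ >
0`. As `τ → 0` the spheres become hyperplanes through the origin, and since `e` is arbitrary, `U` is
radial. -/

theorem laplacian_eq_sum_fderiv (f : EuclideanSpace ℝ ι → ℝ) (x : EuclideanSpace ℝ ι) :
    (Δ f) x = ∑ i, fderiv ℝ (fderiv ℝ f) x (EuclideanSpace.single i 1)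
      (EuclideanSpace.single i 1) := by
  rw [InnerProductSpace.laplacian_eq_iteratedFDeriv_orthonormalBasis f
    (EuclideanSpace.basisFun ι ℝ)]
  simp [iteratedFDeriv_two_apply]

variable {E F : Type*} [NormedAddCommGroup E] [NormedSpace ℝ E] [NormedAddCommGroup F]
  [NormedSpace ℝ F]

theorem hasFDerivAt_fderiv {f : E → ℝ} {x : E} (hf : ContDiffAt ℝ 2 f x) :
    HasFDerivAt (fderiv ℝ f) (fderiv ℝ (fderiv ℝ f) x) x :=
  ((hf.fderiv_right (m := 1) (by norm_num)).differentiableAt (by norm_num)).hasFDerivAt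

theorem eventually_differentiableAt {f : E → ℝ} {x : E} (hf : ContDiffAt ℝ 2 f x) :
    ∀ᶠ z in 𝓝 x, DifferentiableAt ℝ f z := by
  filter_upwards [hf.eventually (by simp)] with z hz
  exact hz.differentiableAt (by norm_num)

theorem fderiv_fderiv_apply {f : E → ℝ} {x : E} (hf : ContDiffAt ℝ 2 f x) (a b : E) :
    fderiv ℝ (fderiv ℝ f) x a b = fderiv ℝ (fun z => fderiv ℝ f z b) x a := by
  rw [((hasFDerivAt_fderiv hf).clm_apply (hasFDerivAt_const b x)).fderiv]
  simp

theorem fderiv_fderiv_comp {f : F → ℝ} {q : E → F} {q' : E → E →L[ℝ] F} {x b : E}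
    {r : E →L[ℝ] F} (hf : ContDiffAt ℝ 2 f (q x)) (hfq : ContDiffAt ℝ 2 (fun z => f (q z)) x)
    (hq : ∀ z, HasFDerivAt q (q' z) z) (hq' : HasFDerivAt (fun z => q' z b) r x) (a : E) :
    fderiv ℝ (fderiv ℝ (fun z => f (q z))) x a b =
      fderiv ℝ (fderiv ℝ f) (q x) (q' x a) (q' x b) + fderiv ℝ f (q x) (r a) := by
  have h1 : (fun z => fderiv ℝ (fun z => f (q z)) z b) =ᶠ[𝓝 x]
      fun z => fderiv ℝ f (q z) (q' z b) := by
    filter_upwards [(hq x).continuousAt.eventually (eventually_differentiableAt hf)] with z hz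
    have h : fderiv ℝ (fun z => f (q z)) z = (fderiv ℝ f (q z)).comp (q' z) :=
      (hz.hasFDerivAt.comp z (hq z)).fderiv
    rw [h]
    rfl
  have h2 := ((hasFDerivAt_fderiv hf).comp x (hq x)).clm_apply hq'
  rw [fderiv_fderiv_apply hfq, h1.fderiv_eq.trans h2.fderiv]
  simp [add_comm]

theorem hasDerivAt_line (x a : E) (t : ℝ) : HasDerivAt (fun t : ℝ => x + t • a) a t := by
  simpa using ((hasDerivAt_id t).smul_const a).const_add x

/-- With a negative second derivative along a line, the second-derivative test would make the point
also a local maximum on that line. The restriction would then be locally constant, with zero second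
derivative. -/
theorem fderiv_fderiv_nonneg_of_isLocalMin {f : E → ℝ} {x : E} (hf : ContDiffAt ℝ 2 f x)
    (hmin : IsLocalMin f x) (a : E) : 0 ≤ fderiv ℝ (fderiv ℝ f) x a a := by
  by_contra! hneg
  set φ : ℝ → ℝ := fun t => f (x + t • a) with hφ
  have hlim : Tendsto (fun t : ℝ => x + t • a) (𝓝 0) (𝓝 x) := by
    simpa using (hasDerivAt_line x a 0).continuousAt.tendsto
  have hd : deriv φ =ᶠ[𝓝 0] fun t => fderiv ℝ f (x + t • a) a := by
    filter_upwards [hlim.eventually (eventually_differentiableAt hf)] with t ht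
    exact (ht.hasFDerivAt.comp_hasDerivAt t (hasDerivAt_line x a t)).deriv
  have hdd : deriv (deriv φ) 0 = fderiv ℝ (fderiv ℝ f) x a a := by
    rw [hd.deriv_eq]
    have h1 : HasDerivAt (fun t : ℝ => fderiv ℝ f (x + t • a)) (fderiv ℝ (fderiv ℝ f) x a) 0 :=
      (hasFDerivAt_fderiv hf).comp_hasDerivAt_of_eq (0 : ℝ) (hasDerivAt_line x a 0) (by simp)
    simpa using (h1.clm_apply (hasDerivAt_const (0 : ℝ) a)).deriv
  have hφmin : IsLocalMin φ 0 := by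
    filter_upwards [hlim.eventually hmin] with t ht
    simpa [hφ] using ht
  have hc : ContinuousAt φ 0 := by
    have h0 : φ 0 = f x := by simp [hφ]
    unfold ContinuousAt
    rw [h0]
    exact hf.continuousAt.tendsto.comp hlim
  have hφmax := isLocalMax_of_deriv_deriv_neg (hdd ▸ hneg) hφmin.deriv_eq_zero hc
  have hconst : φ =ᶠ[𝓝 0] fun _ => φ 0 := by
    filter_upwards [hφmin, hφmax] with t h1 h2 using le_antisymm h2 h1
  have h3 : deriv φ =ᶠ[𝓝 0] fun _ => 0 := by
    filter_upwards [hconst.eventuallyEq_nhds] with t ht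
    rw [ht.deriv_eq]; simp
  have h4 : deriv (deriv φ) 0 = 0 := by rw [h3.deriv_eq]; simp
  rw [hdd] at h4
  exact hneg.ne h4

theorem laplacian_nonneg_of_isLocalMin {f : EuclideanSpace ℝ ι → ℝ} {x : EuclideanSpace ℝ ι}
    (hf : ContDiffAt ℝ 2 f x) (hmin : IsLocalMin f x) : 0 ≤ (Δ f) x := by
  rw [laplacian_eq_sum_fderiv]
  exact Finset.sum_nonneg fun i _ => fderiv_fderiv_nonneg_of_isLocalMin hf hmin _

theorem laplacian_mul {f g : EuclideanSpace ℝ ι → ℝ} {x : EuclideanSpace ℝ ι}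
    (hf : ContDiffAt ℝ 2 f x) (hg : ContDiffAt ℝ 2 g x) :
    (Δ (fun z => f z * g z)) x = f x * (Δ g) x + g x * (Δ f) x +
      2 * ∑ i, fderiv ℝ f x (EuclideanSpace.single i 1) *
        fderiv ℝ g x (EuclideanSpace.single i 1) := by
  have h1 : fderiv ℝ (fun z => f z * g z) =ᶠ[𝓝 x]
      fun z => f z • fderiv ℝ g z + g z • fderiv ℝ f z := by
    filter_upwards [eventually_differentiableAt hf, eventually_differentiableAt hg] with z h1 h2
    exact (h1.hasFDerivAt.mul h2.hasFDerivAt).fderiv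
  have hfx := (hf.differentiableAt (by norm_num)).hasFDerivAt
  have hgx := (hg.differentiableAt (by norm_num)).hasFDerivAt
  have h2 := (hfx.smul (hasFDerivAt_fderiv hg)).add (hgx.smul (hasFDerivAt_fderiv hf))
  have h3 : fderiv ℝ (fderiv ℝ (fun z => f z * g z)) x = _ := h1.fderiv_eq.trans h2.fderiv
  simp only [laplacian_eq_sum_fderiv, h3, Finset.mul_sum, ← Finset.sum_add_distrib]
  refine Finset.sum_congr rfl fun i _ => ?_
  simp
  ring

theorem single_inner_sq_sum (z : EuclideanSpace ℝ ι) :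
    ∑ i, (inner ℝ z (EuclideanSpace.single i (1 : ℝ))) ^ 2 = ‖z‖ ^ 2 := by
  simp [EuclideanSpace.norm_sq_eq, EuclideanSpace.inner_single_right]

omit [DecidableEq ι] in
theorem hasFDerivAt_norm_sq_rpow (t β : ℝ) (e z : EuclideanSpace ℝ ι) (hz : t • z - e ≠ 0) :
    HasFDerivAt (fun z => (‖t • z - e‖ ^ 2) ^ β)
      ((2 * β * t * (‖t • z - e‖ ^ 2) ^ (β - 1)) • innerSL ℝ (t • z - e)) z := by
  have h1 : HasFDerivAt (fun z : EuclideanSpace ℝ ι => t • z - e)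
      (t • ContinuousLinearMap.id ℝ _) z := ((hasFDerivAt_id z).const_smul t).sub_const e
  have hpos : ‖t • z - e‖ ^ 2 ≠ 0 := by simpa using hz
  have h2 := h1.norm_sq.rpow_const (p := β) (Or.inl hpos)
  refine h2.congr_fderiv (ContinuousLinearMap.ext fun a => ?_)
  simp
  ring

omit [DecidableEq ι] in
theorem contDiffAt_norm_sq_rpow (t β : ℝ) (e z : EuclideanSpace ℝ ι) (hz : t • z - e ≠ 0) :
    ContDiffAt ℝ 2 (fun z => (‖t • z - e‖ ^ 2) ^ β) z := by
  have hpos : ‖t • z - e‖ ^ 2 ≠ 0 := by simpa using hz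
  have h1 : ContDiffAt ℝ 2 (fun z : EuclideanSpace ℝ ι => ‖t • z - e‖ ^ 2) z :=
    ContDiffAt.norm_sq ℝ (by fun_prop)
  exact h1.rpow_const_of_ne hpos

/-- Used twice: in `ℝ^n` with `β = weight n` the factor vanishes, giving the harmonic barrier; in
`ℝ^(n+1)` with `β = weight n / 2` it produces the constant `-n(n-2)/4` of the conformal Laplacian.
-/
theorem laplacian_norm_sq_rpow (t β : ℝ) (e z : EuclideanSpace ℝ ι) (hz : t • z - e ≠ 0) :
    (Δ (fun z => (‖t • z - e‖ ^ 2) ^ β)) z =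
      2 * β * t ^ 2 * (2 * (β - 1) + Fintype.card ι) * (‖t • z - e‖ ^ 2) ^ (β - 1) := by
  have hpos : 0 < ‖t • z - e‖ ^ 2 := by positivity
  have hev : ∀ᶠ y in 𝓝 z, t • y - e ≠ 0 :=
    ContinuousAt.eventually_ne (by fun_prop) hz
  have h1 : fderiv ℝ (fun z => (‖t • z - e‖ ^ 2) ^ β) =ᶠ[𝓝 z]
      fun z => (2 * β * t * (‖t • z - e‖ ^ 2) ^ (β - 1)) • innerSL ℝ (t • z - e) := by
    filter_upwards [hev] with y hy using (hasFDerivAt_norm_sq_rpow t β e y hy).fderiv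
  have h2 : HasFDerivAt (fun z : EuclideanSpace ℝ ι => t • z - e)
      (t • ContinuousLinearMap.id ℝ _) z := ((hasFDerivAt_id z).const_smul t).sub_const e
  have hC := contDiffAt_norm_sq_rpow t β e z hz
  have hpow : (‖t • z - e‖ ^ 2) ^ (β - 1) = ‖t • z - e‖ ^ 2 * (‖t • z - e‖ ^ 2) ^ (β - 1 - 1) := by
    rw [Real.rpow_sub_one hpos.ne' (β - 1)]; field_simp
  have hsum := single_inner_sq_sum (t • z - e)
  have key : ∀ i, fderiv ℝ (fderiv ℝ (fun z => (‖t • z - e‖ ^ 2) ^ β)) z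
      (EuclideanSpace.single i 1) (EuclideanSpace.single i 1) =
      2 * β * t ^ 2 * (‖t • z - e‖ ^ 2) ^ (β - 1) +
        4 * β * (β - 1) * t ^ 2 * (‖t • z - e‖ ^ 2) ^ (β - 1 - 1) *
        (inner ℝ (t • z - e) (EuclideanSpace.single i (1 : ℝ))) ^ 2 := by
    intro i
    rw [fderiv_fderiv_apply hC]
    have h3 : (fun y => fderiv ℝ (fun z => (‖t • z - e‖ ^ 2) ^ β) y (EuclideanSpace.single i 1))
        =ᶠ[𝓝 z] fun y => (2 * β * t * (‖t • y - e‖ ^ 2) ^ (β - 1)) *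
          inner ℝ (t • y - e) (EuclideanSpace.single i (1 : ℝ)) := by
      filter_upwards [h1] with y hy
      rw [hy]; rfl
    have h4 := ((hasFDerivAt_norm_sq_rpow t (β - 1) e z hz).const_mul (2 * β * t)).mul
      (h2.inner ℝ (hasFDerivAt_const (EuclideanSpace.single i (1 : ℝ)) z))
    rw [h3.fderiv_eq.trans h4.fderiv]
    simp [fderivInnerCLM_apply, EuclideanSpace.inner_single_right]
    ring
  rw [laplacian_eq_sum_fderiv]
  simp_rw [key]
  rw [Finset.sum_add_distrib, Finset.sum_const, ← Finset.mul_sum, hsum, hpow]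
  simp
  ring

theorem fderiv_homogeneous {V : E → ℝ} {α : ℝ} (hV : ∀ c : ℝ, 0 < c → ∀ x, V (c • x) = c ^ α * V x)
    {c : ℝ} (hc : 0 < c) (x : E) : fderiv ℝ V (c • x) = c ^ (α - 1) • fderiv ℝ V x := by
  have h1 : fderiv ℝ (fun z => V (c • z)) x = c • fderiv ℝ V (c • x) := by
    simpa using fderiv_comp_smul (f := V) (x := x) c
  have h2 : fderiv ℝ (fun z => V (c • z)) x = c ^ α • fderiv ℝ V x := by
    have : (fun z => V (c • z)) = c ^ α • V := by ext z; simp [hV c hc]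
    rw [this, fderiv_const_smul_field]; rfl
  rw [h1] at h2
  rw [Real.rpow_sub_one hc.ne', div_eq_inv_mul, mul_smul, ← h2, smul_smul,
    inv_mul_cancel₀ hc.ne', one_smul]

/-- Euler's identity for the derivative of `V`, which is homogeneous of degree `α - 1`. -/
theorem fderiv_fderiv_self_homogeneous {V : E → ℝ} {α : ℝ}
    (hV : ∀ c : ℝ, 0 < c → ∀ x, V (c • x) = c ^ α * V x) {x : E} (hx : ContDiffAt ℝ 2 V x) :
    fderiv ℝ (fderiv ℝ V) x x = (α - 1) • fderiv ℝ V x := by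
  have h0 : HasDerivAt (fun c : ℝ => c • x) x (1 : ℝ) := by
    have h := (hasDerivAt_id (1 : ℝ)).smul_const x
    rw [one_smul] at h
    exact h
  have h1 : HasDerivAt (fun c : ℝ => fderiv ℝ V (c • x)) (fderiv ℝ (fderiv ℝ V) x x) 1 := by
    have := hasFDerivAt_fderiv hx
    rw [← one_smul ℝ x] at this
    have h2 := this.comp_hasDerivAt (1 : ℝ) h0
    rw [one_smul] at h2
    exact h2
  have h2 : HasDerivAt (fun c : ℝ => c ^ (α - 1) • fderiv ℝ V x) ((α - 1) • fderiv ℝ V x) 1 := by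
    simpa using (Real.hasDerivAt_rpow_const (p := α - 1) (Or.inl one_ne_zero)).smul_const
      (fderiv ℝ V x)
  refine h1.unique (h2.congr_of_eventuallyEq ?_)
  filter_upwards [lt_mem_nhds (zero_lt_one (α := ℝ))] with c hc
  exact fderiv_homogeneous hV hc x

end Calculus

/-! ### The homogeneous extension and the conformal Laplacian -/

section HomogeneousExtension

variable {n : ℕ}

/-- The radial projection of a nonzero vector to the unit sphere. -/
def proj (x : EuclideanSpace ℝ (Fin (n + 1))) (hx : x ≠ 0) : Sph n :=
  ⟨‖x‖⁻¹ • x, by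
    rw [mem_sphere_zero_iff_norm, norm_smul, norm_inv, norm_norm,
      inv_mul_cancel₀ (norm_ne_zero_iff.mpr hx)]⟩

theorem radialExtension_of_ne (f : Sph n → ℝ) {x : EuclideanSpace ℝ (Fin (n + 1))} (hx : x ≠ 0) :
    radialExtension f x = f (proj x hx) := by
  simp [radialExtension, hx, proj]

theorem sph_norm (θ : Sph n) : ‖(θ : EuclideanSpace ℝ (Fin (n + 1)))‖ = 1 :=
  mem_sphere_zero_iff_norm.mp θ.2

theorem sph_ne_zero (θ : Sph n) : (θ : EuclideanSpace ℝ (Fin (n + 1))) ≠ 0 := by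
  rw [← norm_ne_zero_iff, sph_norm]; exact one_ne_zero

theorem proj_coe (θ : Sph n) : proj θ (sph_ne_zero θ) = θ := by
  apply Subtype.ext
  simp [proj]

theorem norm_smul_proj {x : EuclideanSpace ℝ (Fin (n + 1))} (hx : x ≠ 0) :
    ‖x‖ • (proj x hx : EuclideanSpace ℝ (Fin (n + 1))) = x := by
  simp [proj, smul_smul, hx]

theorem height_proj {x : EuclideanSpace ℝ (Fin (n + 1))} (hx : x ≠ 0) :
    height (proj x hx) = x (Fin.last n) / ‖x‖ := by
  simp [height, proj, div_eq_inv_mul]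

theorem radialExtension_smul (f : Sph n → ℝ) {c : ℝ} (hc : 0 < c)
    (x : EuclideanSpace ℝ (Fin (n + 1))) : radialExtension f (c • x) = radialExtension f x := by
  by_cases hx : x = 0
  · simp [hx]
  · have hcx : c • x ≠ 0 := smul_ne_zero hc.ne' hx
    rw [radialExtension_of_ne f hx, radialExtension_of_ne f hcx]
    congr 1
    apply Subtype.ext
    simp only [proj, norm_smul, Real.norm_eq_abs, abs_of_pos hc, smul_smul]
    congr 1
    field_simp

theorem contDiffAt_radialExtension {f : Sph n → ℝ}
    (hf : ContMDiffOn (𝓡 n) 𝓘(ℝ, ℝ) 2 f {north n}ᶜ) {x : EuclideanSpace ℝ (Fin (n + 1))}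
    (hx : x ≠ 0) (hN : proj x hx ≠ north n) : ContDiffAt ℝ 2 (radialExtension f) x := by
  have : Fact (Module.finrank ℝ (EuclideanSpace ℝ (Fin (n + 1))) = n + 1) :=
    ⟨finrank_euclideanSpace_fin⟩
  let U : TopologicalSpace.Opens (EuclideanSpace ℝ (Fin (n + 1))) := ⟨{0}ᶜ, isOpen_compl_singleton⟩
  have hp : ContMDiff 𝓘(ℝ, EuclideanSpace ℝ (Fin (n + 1))) 𝓘(ℝ, EuclideanSpace ℝ (Fin (n + 1))) 2
      (fun z : U => (‖(z : EuclideanSpace ℝ (Fin (n + 1)))‖⁻¹ •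
        (z : EuclideanSpace ℝ (Fin (n + 1))))) := by
    intro z
    refine (contMDiffAt_subtype_iff (U := U) (f := fun z => ‖z‖⁻¹ • z)).mpr ?_
    have hz : (z : EuclideanSpace ℝ (Fin (n + 1))) ≠ 0 := z.2
    refine ContDiffAt.contMDiffAt ?_
    exact ((contDiffAt_norm ℝ hz).inv (norm_ne_zero_iff.mpr hz)).smul contDiffAt_id
  have hU : ∀ z : U, (z : EuclideanSpace ℝ (Fin (n + 1))) ≠ 0 := fun z => z.2
  let P : U → Sph n := fun z => proj z.1 (hU z)
  have hP : ContMDiff 𝓘(ℝ, EuclideanSpace ℝ (Fin (n + 1))) (𝓡 n) 2 P :=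
    hp.codRestrict_sphere (n := n) fun z => (proj z.1 (hU z)).2
  have hfx : ContMDiffAt (𝓡 n) 𝓘(ℝ, ℝ) 2 f (P ⟨x, hx⟩) :=
    hf.contMDiffAt (isOpen_compl_singleton.mem_nhds hN)
  have h3 : ContMDiffAt 𝓘(ℝ, EuclideanSpace ℝ (Fin (n + 1))) 𝓘(ℝ, ℝ) 2 (f ∘ P) ⟨x, hx⟩ :=
    hfx.comp _ (hP _)
  have h4 : f ∘ P = fun z : U => radialExtension f z :=
    funext fun z => (radialExtension_of_ne f (hU z)).symm
  rw [h4] at h3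
  exact (contMDiffAt_subtype_iff.mp h3).contDiffAt

/-- The weight `-(n - 2) / 2` of the conformal Laplacian in dimension `n`. -/
def weight (n : ℕ) : ℝ := -(((n : ℝ) - 2) / 2)

/-- The extension of a function on the sphere which is homogeneous of degree `weight n`. -/
def confExtension (v : Sph n → ℝ) (x : EuclideanSpace ℝ (Fin (n + 1))) : ℝ :=
  ‖x‖ ^ weight n * radialExtension v x

theorem weight_neg (hn : 3 ≤ n) : weight n < 0 := by
  have : (3 : ℝ) ≤ n := by exact_mod_cast hn
  unfold weight; linarith

theorem confExtension_of_ne (v : Sph n → ℝ) {x : EuclideanSpace ℝ (Fin (n + 1))} (hx : x ≠ 0) :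
    confExtension v x = ‖x‖ ^ weight n * v (proj x hx) := by
  rw [confExtension, radialExtension_of_ne v hx]

theorem confExtension_smul (v : Sph n → ℝ) (c : ℝ) (hc : 0 < c)
    (x : EuclideanSpace ℝ (Fin (n + 1))) :
    confExtension v (c • x) = c ^ weight n * confExtension v x := by
  rw [confExtension, confExtension, radialExtension_smul v hc, norm_smul, Real.norm_eq_abs,
    abs_of_pos hc, Real.mul_rpow hc.le (norm_nonneg x), mul_assoc]

theorem norm_rpow_eq (x : EuclideanSpace ℝ (Fin (n + 1))) (a : ℝ) :
    ‖x‖ ^ a = (‖(1 : ℝ) • x - 0‖ ^ 2) ^ (a / 2) := by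
  rw [one_smul, sub_zero, ← Real.rpow_natCast ‖x‖ 2, ← Real.rpow_mul (norm_nonneg x)]
  congr 1
  push_cast; ring

theorem contDiffAt_confExtension {v : Sph n → ℝ}
    (hv : ContMDiffOn (𝓡 n) 𝓘(ℝ, ℝ) 2 v {north n}ᶜ) {x : EuclideanSpace ℝ (Fin (n + 1))}
    (hx : x ≠ 0) (hN : proj x hx ≠ north n) : ContDiffAt ℝ 2 (confExtension v) x := by
  refine ContDiffAt.mul ?_ (contDiffAt_radialExtension hv hx hN)
  simp_rw [norm_rpow_eq]
  exact contDiffAt_norm_sq_rpow _ _ _ _ (by simpa using hx)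

/-- In the product rule the cross term vanishes, because the gradient of `‖x‖ ^ α` is radial and the
other factor is constant along rays. What remains is the spherical Laplacian plus `α (α + n - 1) =
-n(n-2)/4` times `v`. -/
theorem laplacian_confExtension_coe {v : Sph n → ℝ}
    (hv : ContMDiffOn (𝓡 n) 𝓘(ℝ, ℝ) 2 v {north n}ᶜ) {θ : Sph n} (hN : θ ≠ north n) :
    (Δ (confExtension v)) (θ : EuclideanSpace ℝ (Fin (n + 1))) = conformalLaplacian v θ := by
  have hθ := sph_ne_zero θ
  have hθ' : (1 : ℝ) • (θ : EuclideanSpace ℝ (Fin (n + 1))) - 0 ≠ 0 := by simpa using hθ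
  have hF := contDiffAt_radialExtension hv hθ (by rwa [proj_coe])
  have hdef : confExtension v = fun x => (‖(1 : ℝ) • x - 0‖ ^ 2) ^ (weight n / 2) *
      radialExtension v x := by
    ext x; rw [confExtension, norm_rpow_eq]
  have hF0 : fderiv ℝ (radialExtension v) θ (θ : EuclideanSpace ℝ (Fin (n + 1))) = 0 := by
    have h0 : HasDerivAt (fun c : ℝ => c • (θ : EuclideanSpace ℝ (Fin (n + 1)))) θ (1 : ℝ) := by
      have h := (hasDerivAt_id (1 : ℝ)).smul_const (θ : EuclideanSpace ℝ (Fin (n + 1)))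
      rw [one_smul] at h
      exact h
    have h1 := (hF.differentiableAt (by norm_num)).hasFDerivAt.comp_hasDerivAt_of_eq (1 : ℝ) h0
      (by simp)
    refine h1.unique ((hasDerivAt_const (1 : ℝ) (radialExtension v θ)).congr_of_eventuallyEq ?_)
    filter_upwards [lt_mem_nhds (zero_lt_one (α := ℝ))] with c hc
    exact radialExtension_smul v hc _
  have hcross : ∑ i, fderiv ℝ (fun x : EuclideanSpace ℝ (Fin (n + 1)) =>
        (‖(1 : ℝ) • x - 0‖ ^ 2) ^ (weight n / 2)) θ (EuclideanSpace.single i 1) *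
        fderiv ℝ (radialExtension v) θ (EuclideanSpace.single i 1) = 0 := by
    rw [(hasFDerivAt_norm_sq_rpow 1 (weight n / 2) 0 _ hθ').fderiv]
    have hsum : ∑ i, (θ : EuclideanSpace ℝ (Fin (n + 1))) i •
        EuclideanSpace.single i (1 : ℝ) = (θ : EuclideanSpace ℝ (Fin (n + 1))) := by
      have := (EuclideanSpace.basisFun (Fin (n + 1)) ℝ).sum_repr
        (θ : EuclideanSpace ℝ (Fin (n + 1)))
      simpa using this
    have h2 : ∑ i, (θ : EuclideanSpace ℝ (Fin (n + 1))) i *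
        fderiv ℝ (radialExtension v) θ (EuclideanSpace.single i 1) = 0 := by
      have h3 := congrArg (fderiv ℝ (radialExtension v) θ) hsum
      rw [hF0, map_sum] at h3
      simpa using h3
    simp only [smul_apply, innerSL_apply_apply, one_smul, sub_zero, sph_norm,
      EuclideanSpace.inner_single_right, smul_eq_mul, one_pow, Real.one_rpow]
    rw [← mul_zero (2 * (weight n / 2) * 1 * 1), ← h2, Finset.mul_sum]
    refine Finset.sum_congr rfl fun i _ => ?_
    simp
    ring
  rw [hdef, laplacian_mul (contDiffAt_norm_sq_rpow _ _ _ _ hθ') hF, hcross,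
    laplacian_norm_sq_rpow _ _ _ _ hθ', conformalLaplacian, sphereLaplacian,
    radialExtension_of_ne v hθ, proj_coe]
  simp only [one_smul, sub_zero, sph_norm, one_pow, Real.one_rpow, Fintype.card_fin, weight]
  push_cast
  ring

theorem laplacian_comp_smul {ι : Type*} [Fintype ι] [DecidableEq ι] {f : EuclideanSpace ℝ ι → ℝ}
    {c : ℝ} {x : EuclideanSpace ℝ ι} (hf : ContDiffAt ℝ 2 f (c • x)) :
    (Δ (fun z => f (c • z))) x = c ^ 2 * (Δ f) (c • x) := by
  rw [laplacian_eq_sum_fderiv, laplacian_eq_sum_fderiv, Finset.mul_sum]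
  refine Finset.sum_congr rfl fun i _ => ?_
  rw [fderiv_fderiv_comp (q := fun z => c • z) (q' := fun _ => c • ContinuousLinearMap.id ℝ _)
    (r := 0) hf (hf.comp x (by fun_prop)) (fun z => (hasFDerivAt_id z).const_smul c)
    (hasFDerivAt_const _ _)]
  simp
  ring

theorem laplacian_confExtension {v : Sph n → ℝ}
    (hv : ContMDiffOn (𝓡 n) 𝓘(ℝ, ℝ) 2 v {north n}ᶜ) {x : EuclideanSpace ℝ (Fin (n + 1))}
    (hx : x ≠ 0) (hN : proj x hx ≠ north n) :
    (Δ (confExtension v)) x = ‖x‖ ^ (weight n - 2) * conformalLaplacian v (proj x hx) := by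
  have hpos : 0 < ‖x‖ := norm_pos_iff.mpr hx
  have hsm := norm_smul_proj hx
  have h1 := laplacian_comp_smul (f := confExtension v) (c := ‖x‖)
    (x := (proj x hx : EuclideanSpace ℝ (Fin (n + 1))))
    (by rw [hsm]; exact contDiffAt_confExtension hv hx hN)
  have h2 : (fun z => confExtension v (‖x‖ • z)) = ‖x‖ ^ weight n • confExtension v := by
    ext z; simp [confExtension_smul v ‖x‖ hpos]
  have h3 : ContDiffAt ℝ 2 (confExtension v) (proj x hx : EuclideanSpace ℝ (Fin (n + 1))) :=
    contDiffAt_confExtension hv (sph_ne_zero _) (by rwa [proj_coe])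
  rw [h2, InnerProductSpace.laplacian_smul _ h3, laplacian_confExtension_coe hv hN, hsm] at h1
  rw [Real.rpow_sub hpos, Real.rpow_two, div_mul_eq_mul_div, eq_div_iff (by positivity), mul_comm]
  exact h1.symm

end HomogeneousExtension

/-! ### Stereographic projection, inversions and their quadratic lifts -/

section Stereographic

variable {n : ℕ}

/-- The inclusion of `ℝ^n` in `ℝ^(n+1)` as the hyperplane orthogonal to the axis. -/
def incl : EuclideanSpace ℝ (Fin n) →L[ℝ] EuclideanSpace ℝ (Fin (n + 1)) :=
  LinearMap.toContinuousLinearMap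
    { toFun := fun y => WithLp.toLp 2 (Fin.snoc (α := fun _ => ℝ) y 0)
      map_add' := fun y z => by
        ext i
        refine Fin.lastCases ?_ (fun j => ?_) i <;> simp
      map_smul' := fun c y => by
        ext i
        refine Fin.lastCases ?_ (fun j => ?_) i <;> simp }

@[simp] theorem incl_castSucc (y : EuclideanSpace ℝ (Fin n)) (i : Fin n) :
    incl y i.castSucc = y i := by simp [incl]

@[simp] theorem incl_last (y : EuclideanSpace ℝ (Fin n)) : incl y (Fin.last n) = 0 := by
  simp [incl]

theorem incl_single (i : Fin n) :
    incl (EuclideanSpace.single i (1 : ℝ)) = EuclideanSpace.single i.castSucc 1 := by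
  ext j
  refine Fin.lastCases ?_ (fun k => ?_) j
  · simp [(Fin.castSucc_lt_last i).ne]
  · simp

/-- The unit vector on the axis. -/
def pole (n : ℕ) : EuclideanSpace ℝ (Fin (n + 1)) := EuclideanSpace.single (Fin.last n) 1

theorem coe_north : (north n : EuclideanSpace ℝ (Fin (n + 1))) = pole n := rfl

@[simp] theorem pole_castSucc (i : Fin n) : pole n i.castSucc = 0 := by
  simp [pole]

@[simp] theorem pole_last : pole n (Fin.last n) = 1 := by simp [pole]

theorem norm_sq_incl_add (z : EuclideanSpace ℝ (Fin n)) (c : ℝ) :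
    ‖incl z + c • pole n‖ ^ 2 = ‖z‖ ^ 2 + c ^ 2 := by
  simp [EuclideanSpace.norm_sq_eq, Fin.sum_univ_castSucc]

/-- The condition `‖z‖ ^ 2 = a * b` says that `(z, (a - b) / 2, (a + b) / 2)` lies on the light
cone; both lifts below have this form. -/
theorem norm_incl_add {z : EuclideanSpace ℝ (Fin n)} {a b : ℝ} (h : ‖z‖ ^ 2 = a * b)
    (hab : 0 ≤ a + b) : ‖incl z + ((a - b) / 2) • pole n‖ = (a + b) / 2 := by
  rw [← sq_eq_sq₀ (norm_nonneg _) (by linarith), norm_sq_incl_add, h]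
  ring

theorem incl_add_last (z : EuclideanSpace ℝ (Fin n)) (c : ℝ) :
    (incl z + c • pole n) (Fin.last n) = c := by simp

/-- The inverse stereographic projection from the north pole, up to a positive factor. -/
def stereo (y : EuclideanSpace ℝ (Fin n)) : EuclideanSpace ℝ (Fin (n + 1)) :=
  incl y + ((‖y‖ ^ 2 - 1) / 2) • pole n

/-- `powerFn e τ y` vanishes on the sphere through the origin which has centre `τ⁻¹ • e`, and is
positive outside of it. -/
def powerFn (e : EuclideanSpace ℝ (Fin n)) (τ : ℝ) (y : EuclideanSpace ℝ (Fin n)) : ℝ :=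
  τ * ‖y‖ ^ 2 - 2 * inner ℝ e y

/-- The square of the ratio of the distance to the centre `τ⁻¹ • e` and of the radius. -/
def ratioSq (e : EuclideanSpace ℝ (Fin n)) (τ : ℝ) (y : EuclideanSpace ℝ (Fin n)) : ℝ :=
  ‖τ • y - e‖ ^ 2

/-- The inversion in the sphere through the origin with centre `τ⁻¹ • e` (for `τ = 0`, the
reflection in the hyperplane orthogonal to `e`), lifted to the multiples of points of the sphere. -/
def stereoInv (e : EuclideanSpace ℝ (Fin n)) (τ : ℝ) (y : EuclideanSpace ℝ (Fin n)) :
    EuclideanSpace ℝ (Fin (n + 1)) :=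
  stereo y + powerFn e τ y • (incl e - (τ / 2) • pole n)

/-- The inversion in the sphere through the origin with centre `τ⁻¹ • e`. -/
def sphereInv (e : EuclideanSpace ℝ (Fin n)) (τ : ℝ) (y : EuclideanSpace ℝ (Fin n)) :
    EuclideanSpace ℝ (Fin n) :=
  (ratioSq e τ y)⁻¹ • (y + powerFn e τ y • e)

variable {e : EuclideanSpace ℝ (Fin n)}

theorem ratioSq_eq (he : ‖e‖ = 1) (τ : ℝ) (y : EuclideanSpace ℝ (Fin n)) :
    ratioSq e τ y = 1 + τ * powerFn e τ y := by
  rw [ratioSq, powerFn, norm_sub_sq_real, norm_smul, inner_smul_left, real_inner_comm, he, mul_pow,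
    Real.norm_eq_abs, sq_abs]
  simp
  ring

theorem norm_sq_add_powerFn (he : ‖e‖ = 1) (τ : ℝ) (y : EuclideanSpace ℝ (Fin n)) :
    ‖y + powerFn e τ y • e‖ ^ 2 = ‖y‖ ^ 2 * ratioSq e τ y := by
  rw [ratioSq_eq he, norm_add_sq_real, norm_smul, inner_smul_right, real_inner_comm, he,
    Real.norm_eq_abs, mul_one, sq_abs, powerFn]
  ring

theorem stereoInv_eq (he : ‖e‖ = 1) (τ : ℝ) (y : EuclideanSpace ℝ (Fin n)) :
    stereoInv e τ y = incl (y + powerFn e τ y • e) +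
      ((‖y‖ ^ 2 - ratioSq e τ y) / 2) • pole n := by
  rw [stereoInv, stereo, ratioSq_eq he, map_add, map_smul]
  module

theorem norm_stereo (y : EuclideanSpace ℝ (Fin n)) : ‖stereo y‖ = (‖y‖ ^ 2 + 1) / 2 :=
  norm_incl_add (by ring) (by positivity)

theorem norm_stereoInv (he : ‖e‖ = 1) (τ : ℝ) (y : EuclideanSpace ℝ (Fin n)) :
    ‖stereoInv e τ y‖ = (‖y‖ ^ 2 + ratioSq e τ y) / 2 := by
  rw [stereoInv_eq he]
  exact norm_incl_add (norm_sq_add_powerFn he τ y) (by unfold ratioSq; positivity)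

theorem stereo_ne_zero (y : EuclideanSpace ℝ (Fin n)) : stereo y ≠ 0 := by
  rw [← norm_ne_zero_iff, norm_stereo]; positivity

theorem height_north : height (north n) = 1 := by simp [height, north]

theorem height_proj_stereo (y : EuclideanSpace ℝ (Fin n)) :
    height (proj (stereo y) (stereo_ne_zero y)) = (‖y‖ ^ 2 - 1) / (‖y‖ ^ 2 + 1) := by
  rw [height_proj, norm_stereo, stereo, incl_add_last]
  field_simp

theorem proj_stereo_ne_north (y : EuclideanSpace ℝ (Fin n)) :
    proj (stereo y) (stereo_ne_zero y) ≠ north n := by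
  intro h
  have h1 := congrArg height h
  rw [height_proj_stereo, height_north, div_eq_one_iff_eq (by positivity)] at h1
  linarith

theorem stereoInv_ne_zero (he : ‖e‖ = 1) {τ : ℝ} {y : EuclideanSpace ℝ (Fin n)}
    (h : 0 < ratioSq e τ y) : stereoInv e τ y ≠ 0 := by
  rw [← norm_ne_zero_iff, norm_stereoInv he]; positivity

theorem height_proj_stereoInv (he : ‖e‖ = 1) {τ : ℝ} {y : EuclideanSpace ℝ (Fin n)}
    (h : 0 < ratioSq e τ y) : height (proj (stereoInv e τ y) (stereoInv_ne_zero he h)) =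
      (‖y‖ ^ 2 - ratioSq e τ y) / (‖y‖ ^ 2 + ratioSq e τ y) := by
  rw [height_proj, norm_stereoInv he, stereoInv_eq he, incl_add_last]
  field_simp

theorem proj_stereoInv_ne_north (he : ‖e‖ = 1) {τ : ℝ} {y : EuclideanSpace ℝ (Fin n)}
    (h : 0 < ratioSq e τ y) : proj (stereoInv e τ y) (stereoInv_ne_zero he h) ≠ north n := by
  intro h'
  have h1 := congrArg height h'
  rw [height_proj_stereoInv he h, height_north, div_eq_one_iff_eq (by positivity)] at h1
  linarith

theorem stereoInv_eq_smul (he : ‖e‖ = 1) {τ : ℝ} {y : EuclideanSpace ℝ (Fin n)}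
    (h : 0 < ratioSq e τ y) : stereoInv e τ y = ratioSq e τ y • stereo (sphereInv e τ y) := by
  have h1 : ‖sphereInv e τ y‖ ^ 2 = (ratioSq e τ y)⁻¹ * ‖y‖ ^ 2 := by
    rw [sphereInv, norm_smul, mul_pow, norm_sq_add_powerFn he, Real.norm_eq_abs, sq_abs]
    field_simp
  rw [stereoInv_eq he, stereo, h1, smul_add, smul_smul, ← map_smul, sphereInv, smul_smul,
    mul_inv_cancel₀ h.ne', one_smul]
  congr 2
  field_simp

theorem sphereInv_eq (he : ‖e‖ = 1) {τ : ℝ} (hτ : τ ≠ 0) {y : EuclideanSpace ℝ (Fin n)}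
    (h : 0 < ratioSq e τ y) :
    sphereInv e τ y = τ⁻¹ • e + (ratioSq e τ y)⁻¹ • (y - τ⁻¹ • e) := by
  have h1 : τ⁻¹ • e = (ratioSq e τ y)⁻¹ • ((ratioSq e τ y * τ⁻¹) • e) := by
    rw [smul_smul]; congr 1; field_simp
  have h2 : ratioSq e τ y * τ⁻¹ = τ⁻¹ + powerFn e τ y := by
    rw [ratioSq_eq he]; field_simp
  rw [sphereInv]
  conv_rhs => lhs; rw [h1, h2]
  rw [← smul_add]
  congr 1
  module

section Conformal

variable {V : EuclideanSpace ℝ (Fin (n + 1)) → ℝ}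

/-- The Hessian of `q` is the inner product times the fixed vector `M = pole n + 2τ m`, so the chain
rule leaves the first-order term `n · DV(M)`. Euler's identity turns it into `-2 D²V(q, M)`, since
`n = -2(α - 1)`, and this cancels the terms by which the pulled-back Hessian trace differs from the
full one. The case `m = 0` is `stereo`, the other is `stereoInv`. -/
theorem laplacian_comp_quadratic
    (hV : ∀ c : ℝ, 0 < c → ∀ x, V (c • x) = c ^ weight n * V x)
    {m : EuclideanSpace ℝ (Fin (n + 1))} {τ : ℝ} (hm : m = 0 ∨ ‖e‖ = 1 ∧ m = incl e - (τ / 2) • pole n)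
    {y : EuclideanSpace ℝ (Fin n)} (hq : ContDiffAt ℝ 2 V (stereo y + powerFn e τ y • m)) :
    ContDiffAt ℝ 2 (fun y => V (stereo y + powerFn e τ y • m)) y ∧
    (Δ (fun y => V (stereo y + powerFn e τ y • m))) y =
      (Δ V) (stereo y + powerFn e τ y • m) := by
  set q : EuclideanSpace ℝ (Fin n) → EuclideanSpace ℝ (Fin (n + 1)) :=
    fun y => stereo y + powerFn e τ y • m with hqdef
  set M := pole n + (2 * τ) • m with hM
  set q' : EuclideanSpace ℝ (Fin n) → EuclideanSpace ℝ (Fin n) →L[ℝ]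
      EuclideanSpace ℝ (Fin (n + 1)) :=
    fun y => incl - (2 : ℝ) • (innerSL ℝ e).smulRight m + (innerSL ℝ y).smulRight M with hq'def
  have hqd : ∀ z, HasFDerivAt q (q' z) z := by
    intro z
    have h1 := (hasFDerivAt_id z).norm_sq
    have h2 : HasFDerivAt (fun y => inner ℝ e y) (innerSL ℝ e) z := (innerSL ℝ e).hasFDerivAt
    have h3 : HasFDerivAt (fun y : EuclideanSpace ℝ (Fin n) => incl y) incl z :=
      incl.hasFDerivAt
    have h4 := (h3.add (((h1.sub_const 1).mul_const (1 / 2)).smul_const (pole n))).add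
      (((h1.const_mul τ).sub (h2.const_mul 2)).smul_const m)
    refine (h4.congr_fderiv (ContinuousLinearMap.ext fun a => ?_)).congr_of_eventuallyEq
      (Eventually.of_forall fun w => ?_)
    · simp [hq'def, hM]
      module
    · simp [hqdef, stereo, powerFn, div_eq_mul_inv]
  have hqc : ContDiff ℝ 2 q := by
    have h1 : ContDiff ℝ 2 (fun y : EuclideanSpace ℝ (Fin n) => ‖y‖ ^ 2) := contDiff_norm_sq ℝ
    have h2 : ContDiff ℝ 2 (fun y : EuclideanSpace ℝ (Fin n) => inner ℝ e y) :=
      (innerSL ℝ e).contDiff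
    exact (incl.contDiff.add (((h1.sub contDiff_const).div_const 2).smul contDiff_const)).add
      (((contDiff_const.mul h1).sub (contDiff_const.mul h2)).smul contDiff_const)
  have hVq : ContDiffAt ℝ 2 (fun y => V (q y)) y := hq.comp y hqc.contDiffAt
  refine ⟨hVq, ?_⟩
  change (Δ (fun y => V (q y))) y = (Δ V) (q y)
  have key : ∀ i, fderiv ℝ (fderiv ℝ (fun y => V (q y))) y (EuclideanSpace.single i 1)
      (EuclideanSpace.single i 1) =
      fderiv ℝ (fderiv ℝ V) (q y) (q' y (EuclideanSpace.single i 1))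
        (q' y (EuclideanSpace.single i 1)) + fderiv ℝ V (q y) M := by
    intro i
    have h1 : HasFDerivAt (fun z => q' z (EuclideanSpace.single i 1))
        ((innerSL ℝ (EuclideanSpace.single i (1 : ℝ))).smulRight M) y := by
      have h2 : HasFDerivAt (fun z : EuclideanSpace ℝ (Fin n) =>
          inner ℝ (EuclideanSpace.single i (1 : ℝ)) z)
          (innerSL ℝ (EuclideanSpace.single i (1 : ℝ))) y := (innerSL ℝ _).hasFDerivAt
      have h3 := (h2.smul_const M).const_add
        (incl (EuclideanSpace.single i 1) - (2 : ℝ) • (e i • m))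
      refine h3.congr_of_eventuallyEq (Eventually.of_forall fun w => ?_)
      simp [hq'def, EuclideanSpace.inner_single_left, EuclideanSpace.inner_single_right]
    rw [fderiv_fderiv_comp (q := q) hq hVq hqd h1]
    simp
  set B := fderiv ℝ (fderiv ℝ V) (q y) with hB
  have hsymm : ∀ a b, B a b = B b a := fun a b =>
    (hq.isSymmSndFDerivAt (by simp)).eq a b
  have hself : ∀ b, B (q y) b = (weight n - 1) * fderiv ℝ V (q y) b := fun b => by
    rw [hB, fderiv_fderiv_self_homogeneous hV (x := q y) hq]; rfl
  have hsum : ∀ (c : EuclideanSpace ℝ (Fin n)) (b : EuclideanSpace ℝ (Fin (n + 1))),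
      ∑ i, c i * B (incl (EuclideanSpace.single i 1)) b = B (incl c) b := by
    intro c b
    have h1 : ∑ i, c i • EuclideanSpace.single i (1 : ℝ) = c := by
      simpa using (EuclideanSpace.basisFun (Fin n) ℝ).sum_repr c
    conv_rhs => rw [← h1]
    simp [map_sum]
  have hin : ∑ i, e i * y i = inner ℝ e y := by
    simp [PiLp.inner_apply, mul_comm]
  have hyy : ∑ i, y i * y i = ‖y‖ ^ 2 := by
    rw [EuclideanSpace.norm_sq_eq]; simp [sq]
  have hee : ∑ i, e i * e i = ‖e‖ ^ 2 := by
    rw [EuclideanSpace.norm_sq_eq]; simp [sq]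
  have hexp : ∀ i, B (q' y (EuclideanSpace.single i 1)) (q' y (EuclideanSpace.single i 1)) =
      B (incl (EuclideanSpace.single i 1)) (incl (EuclideanSpace.single i 1)) +
      -4 * (e i * B (incl (EuclideanSpace.single i 1)) m) +
      2 * (y i * B (incl (EuclideanSpace.single i 1)) M) +
      4 * B m m * (e i * e i) - 4 * B m M * (e i * y i) + B M M * (y i * y i) := by
    intro i
    have h1 : q' y (EuclideanSpace.single i 1) =
        incl (EuclideanSpace.single i 1) - (2 * e i) • m + y i • M := by
      simp [hq'def, EuclideanSpace.inner_single_right, smul_smul]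
    rw [h1]
    simp only [map_add, map_sub, map_smul, add_apply, sub_apply, smul_apply, smul_eq_mul]
    rw [hsymm m (incl _), hsymm M (incl _), hsymm M m]
    ring
  rw [laplacian_eq_sum_fderiv, laplacian_eq_sum_fderiv, Fin.sum_univ_castSucc]
  simp_rw [key, hexp, ← incl_single]
  simp only [Finset.sum_add_distrib, Finset.sum_sub_distrib, ← Finset.mul_sum, hsum, hin, hyy, hee,
    Finset.sum_const, Finset.card_univ, Fintype.card_fin, nsmul_eq_mul]
  change _ = _ + B (pole n) (pole n)
  have h1 := hself M
  have h2 : B (q y) M = B (incl y) M + (‖y‖ ^ 2 - 1) / 2 * B (pole n) M +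
      powerFn e τ y * B m M := by
    simp [hqdef, stereo]
  rw [h2, powerFn] at h1
  have h3 : ∀ b, B M b = B (pole n) b + 2 * τ * B m b := fun b => by simp [hM]
  have h4 : B (pole n) M = B (pole n) (pole n) + 2 * τ * B (pole n) m := by simp [hM]
  -- The only place where the specific form of `m` enters.
  have h5 : 4 * B (incl e) m = 4 * ‖e‖ ^ 2 * B m m + 2 * τ * B (pole n) m := by
    rcases hm with rfl | ⟨he, hm⟩
    · simp
    · have : incl e = m + (τ / 2) • pole n := by rw [hm]; module
      rw [this, he]
      simp
      ring
  rw [h4] at h1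
  rw [h3 M, h4]
  have h6 : (n : ℝ) = -2 * (weight n - 1) := by unfold weight; ring
  rw [h6]
  linear_combination 2 * h1 - h5

end Conformal

end Stereographic

/-! ### Kelvin transforms, maximum principle and Hopf-type estimates -/

section MovingSpheres

variable {n : ℕ}

/-- The Kelvin transform of a function in the sphere through the origin with centre `τ⁻¹ • e`. -/
def kelvin (U : EuclideanSpace ℝ (Fin n) → ℝ) (e : EuclideanSpace ℝ (Fin n)) (τ : ℝ)
    (y : EuclideanSpace ℝ (Fin n)) : ℝ :=
  ratioSq e τ y ^ weight n * U (sphereInv e τ y)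

variable {U : EuclideanSpace ℝ (Fin n) → ℝ} {e : EuclideanSpace ℝ (Fin n)} {τ : ℝ}

theorem continuous_powerFn (e : EuclideanSpace ℝ (Fin n)) :
    Continuous fun p : ℝ × EuclideanSpace ℝ (Fin n) => powerFn e p.1 p.2 := by
  unfold powerFn; fun_prop

theorem continuous_ratioSq (e : EuclideanSpace ℝ (Fin n)) :
    Continuous fun p : ℝ × EuclideanSpace ℝ (Fin n) => ratioSq e p.1 p.2 := by
  unfold ratioSq; fun_prop

theorem continuousAt_sphereInv {p : ℝ × EuclideanSpace ℝ (Fin n)} (h : 0 < ratioSq e p.1 p.2) :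
    ContinuousAt (fun p : ℝ × EuclideanSpace ℝ (Fin n) => sphereInv e p.1 p.2) p :=
  ((continuous_ratioSq e).continuousAt.inv₀ h.ne').smul
    (continuous_snd.add ((continuous_powerFn e).smul continuous_const)).continuousAt

theorem continuousAt_kelvin (hU : Continuous U) {p : ℝ × EuclideanSpace ℝ (Fin n)}
    (h : 0 < ratioSq e p.1 p.2) :
    ContinuousAt (fun p : ℝ × EuclideanSpace ℝ (Fin n) => kelvin U e p.1 p.2) p :=
  ((continuous_ratioSq e).continuousAt.rpow_const (Or.inl h.ne')).mul
    (ContinuousAt.comp hU.continuousAt (continuousAt_sphereInv h))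

theorem continuousAt_kelvin_right (hU : Continuous U) {y : EuclideanSpace ℝ (Fin n)}
    (h : 0 < ratioSq e τ y) : ContinuousAt (fun y => kelvin U e τ y) y :=
  ContinuousAt.comp (f := fun y => (τ, y)) (continuousAt_kelvin (p := (τ, y)) hU h)
    (by fun_prop)

theorem continuous_ratioSq_right (e : EuclideanSpace ℝ (Fin n)) (τ : ℝ) :
    Continuous fun y => ratioSq e τ y := by
  unfold ratioSq; fun_prop

theorem one_lt_ratioSq_iff (he : ‖e‖ = 1) (hτ : 0 < τ) {y : EuclideanSpace ℝ (Fin n)} :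
    1 < ratioSq e τ y ↔ 0 < powerFn e τ y := by
  rw [ratioSq_eq he]; simp [hτ]

theorem powerFn_eq_zero (he : ‖e‖ = 1) (hτ : 0 < τ) {y : EuclideanSpace ℝ (Fin n)}
    (h : ratioSq e τ y = 1) : powerFn e τ y = 0 := by
  rw [ratioSq_eq he] at h
  simpa [hτ.ne'] using h

theorem sphereInv_of_powerFn_eq_zero (he : ‖e‖ = 1) {y : EuclideanSpace ℝ (Fin n)}
    (h : powerFn e τ y = 0) : sphereInv e τ y = y := by
  simp [sphereInv, ratioSq_eq he, h]

theorem kelvin_of_powerFn_eq_zero (he : ‖e‖ = 1) {y : EuclideanSpace ℝ (Fin n)}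
    (h : powerFn e τ y = 0) : kelvin U e τ y = U y := by
  simp [kelvin, sphereInv_of_powerFn_eq_zero he h, ratioSq_eq he, h]

theorem isCompact_ratioSq_mem_Icc (e : EuclideanSpace ℝ (Fin n)) (hτ : 0 < τ) (a b : ℝ) :
    IsCompact {y | ratioSq e τ y ∈ Icc a b} := by
  refine Metric.isCompact_of_isClosed_isBounded
    (isClosed_Icc.preimage (continuous_ratioSq_right e τ)) ?_
  refine (Metric.isBounded_closedBall (x := (0 : EuclideanSpace ℝ (Fin n)))
    (r := (b + 1 + ‖e‖) / τ)).subset fun y hy => ?_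
  rw [mem_closedBall_zero_iff, le_div_iff₀ hτ]
  have h1 : ‖τ • y - e‖ ^ 2 ≤ b := hy.2
  have h2 : ‖τ • y‖ ≤ ‖τ • y - e‖ + ‖e‖ := by
    simpa using norm_add_le (τ • y - e) e
  rw [norm_smul, Real.norm_eq_abs, abs_of_pos hτ] at h2
  nlinarith [sq_nonneg (‖τ • y - e‖ - 1), norm_nonneg (τ • y - e)]

/-- `U` dominates its Kelvin transform outside of the sphere. -/
def Dominates (U : EuclideanSpace ℝ (Fin n) → ℝ) (e : EuclideanSpace ℝ (Fin n)) (τ : ℝ) : Prop :=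
  ∀ y, 0 < powerFn e τ y → kelvin U e τ y ≤ U y

/-- Wherever `U` dominates its Kelvin transform outside of the sphere, the difference is strictly
superharmonic. -/
def SuperharmonicDiff (U : EuclideanSpace ℝ (Fin n) → ℝ) (e : EuclideanSpace ℝ (Fin n)) (τ : ℝ) :
    Prop :=
  ∀ y, 0 < powerFn e τ y → ContDiffAt ℝ 2 (fun y => kelvin U e τ y) y ∧
    (kelvin U e τ y ≤ U y → (Δ U) y < (Δ (fun y => kelvin U e τ y)) y)

/-- The barrier `a + b κ ^ α` is harmonic, being a constant plus a multiple of the fundamental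
solution centred at `τ⁻¹ • e`. A negative interior minimum of the difference would have nonnegative
Laplacian, against strict superharmonicity. -/
theorem annulus_comparison (hU : ContDiff ℝ 2 U) (he : ‖e‖ = 1) (hτ : 0 < τ)
    (hS : SuperharmonicDiff U e τ) (hD : Dominates U e τ) {a b κ₁ κ₂ : ℝ} (hκ₁ : 1 ≤ κ₁)
    (h₁ : ∀ y, ratioSq e τ y = κ₁ → a + b * κ₁ ^ weight n ≤ U y - kelvin U e τ y)
    (h₂ : ∀ y, ratioSq e τ y = κ₂ → a + b * κ₂ ^ weight n ≤ U y - kelvin U e τ y)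
    {y : EuclideanSpace ℝ (Fin n)} (hy : ratioSq e τ y ∈ Icc κ₁ κ₂) :
    a + b * ratioSq e τ y ^ weight n ≤ U y - kelvin U e τ y := by
  set K := {y | ratioSq e τ y ∈ Icc κ₁ κ₂}
  set φ : EuclideanSpace ℝ (Fin n) → ℝ :=
    fun y => U y - kelvin U e τ y - (a + b * ratioSq e τ y ^ weight n) with hφ
  have hpos : ∀ z ∈ K, 0 < ratioSq e τ z := fun z hz => zero_lt_one.trans_le (hκ₁.trans hz.1)
  have hcont : ContinuousOn φ K := fun z hz =>
    ((hU.continuous.continuousAt.sub (continuousAt_kelvin_right hU.continuous (hpos z hz))).sub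
      (continuousAt_const.add (continuousAt_const.mul
      ((continuous_ratioSq_right e τ).continuousAt.rpow_const
        (Or.inl (hpos z hz).ne'))))).continuousWithinAt
  obtain ⟨z, hzK, hz⟩ := (isCompact_ratioSq_mem_Icc e hτ κ₁ κ₂).exists_isMinOn ⟨y, hy⟩ hcont
  suffices h : 0 ≤ φ z by
    have := h.trans (hz hy)
    simp only [hφ] at this
    linarith
  by_contra! hneg
  have hz1 : κ₁ < ratioSq e τ z := by
    refine lt_of_le_of_ne hzK.1 fun h => ?_
    have := h₁ z h.symm
    simp only [hφ, ← h] at hneg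
    linarith
  have hz2 : ratioSq e τ z < κ₂ := by
    refine lt_of_le_of_ne hzK.2 fun h => ?_
    have := h₂ z h
    simp only [hφ, h] at hneg
    linarith
  have hmem : K ∈ 𝓝 z := by
    filter_upwards [(continuous_ratioSq_right e τ).continuousAt.eventually
      (Icc_mem_nhds hz1 hz2)] with w hw using hw
  have hloc : IsLocalMin φ z := hz.isLocalMin hmem
  have hμ : 0 < powerFn e τ z := (one_lt_ratioSq_iff he hτ).mp (hκ₁.trans_lt hz1)
  obtain ⟨hk, hk'⟩ := hS z hμ
  have hne : τ • z - e ≠ 0 := by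
    have := hpos z hzK
    intro h
    simp [ratioSq, h] at this
  have hrC : ContDiffAt ℝ 2 (fun y => ratioSq e τ y ^ weight n) z :=
    contDiffAt_norm_sq_rpow τ (weight n) e z hne
  have hrΔ : (Δ (fun y => ratioSq e τ y ^ weight n)) z = 0 := by
    have h := laplacian_norm_sq_rpow τ (weight n) e z hne
    have h0 : 2 * (weight n - 1) + (Fintype.card (Fin n) : ℝ) = 0 := by
      simp [weight]
      ring
    rw [h0] at h
    simpa [ratioSq] using h
  have hφ' : φ = U - (fun y => kelvin U e τ y) -
      ((fun _ => a) + b • fun y => ratioSq e τ y ^ weight n) := by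
    ext w; simp [hφ]
  have hUz := hU.contDiffAt (x := z)
  have hbC : ContDiffAt ℝ 2 (b • fun y => ratioSq e τ y ^ weight n) z := hrC.const_smul b
  have hcC : ContDiffAt ℝ 2 (fun _ : EuclideanSpace ℝ (Fin n) => a) z := contDiffAt_const
  have hC₁ : ContDiffAt ℝ 2 (U - fun y => kelvin U e τ y) z := hUz.sub hk
  have hC₂ : ContDiffAt ℝ 2 ((fun _ : EuclideanSpace ℝ (Fin n) => a) +
    b • fun y => ratioSq e τ y ^ weight n) z := hcC.add hbC
  have h0 := laplacian_nonneg_of_isLocalMin (by rw [hφ']; exact hC₁.sub hC₂) hloc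
  rw [hφ', hC₁.laplacian_sub hC₂, hUz.laplacian_sub hk, hcC.laplacian_add hbC,
    InnerProductSpace.laplacian_smul b hrC, hrΔ] at h0
  have h1 := hk' (hD z hμ)
  simp at h0
  linarith

/-- Since superharmonicity is strict, no strong maximum principle is needed: a contact point would
be a local minimum with negative Laplacian. -/
theorem kelvin_lt (hU : ContDiff ℝ 2 U)
    (hS : SuperharmonicDiff U e τ) (hD : Dominates U e τ) {y : EuclideanSpace ℝ (Fin n)}
    (hy : 0 < powerFn e τ y) : kelvin U e τ y < U y := by
  refine lt_of_le_of_ne (hD y hy) fun h => ?_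
  obtain ⟨hk, hk'⟩ := hS y hy
  have hUy := hU.contDiffAt (x := y)
  have hcp : Continuous fun y => powerFn e τ y := by unfold powerFn; fun_prop
  have hloc : IsLocalMin (U - fun y => kelvin U e τ y) y := by
    filter_upwards [hcp.continuousAt.eventually (lt_mem_nhds hy)] with z hz
    have := hD z hz
    simp [h, this]
  have hC : ContDiffAt ℝ 2 (U - fun y => kelvin U e τ y) y := hUy.sub hk
  have h0 := laplacian_nonneg_of_isLocalMin hC hloc
  rw [hUy.laplacian_sub hk] at h0
  linarith [hk' h.le]

theorem exists_lower_bound (hn : 3 ≤ n) (hU : ContDiff ℝ 2 U) (he : ‖e‖ = 1) (hτ : 0 < τ)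
    (hS : SuperharmonicDiff U e τ) (hD : Dominates U e τ) :
    ∃ m : ℝ, 0 < m ∧
      (∀ y, ratioSq e τ y ∈ Icc 1 4 →
        m * (1 - ratioSq e τ y ^ weight n) ≤ U y - kelvin U e τ y) ∧
      (∀ y, 4 ≤ ratioSq e τ y → m * ratioSq e τ y ^ weight n ≤ U y - kelvin U e τ y) := by
  have hα := weight_neg hn
  have hpos : ∀ {y : EuclideanSpace ℝ (Fin n)}, 1 < ratioSq e τ y → 0 < U y - kelvin U e τ y :=
    fun h => sub_pos.mpr (kelvin_lt hU hS hD ((one_lt_ratioSq_iff he hτ).mp h))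
  have hnonneg : ∀ {y : EuclideanSpace ℝ (Fin n)}, 1 ≤ ratioSq e τ y →
      0 ≤ U y - kelvin U e τ y := by
    intro y h
    rcases h.lt_or_eq with h | h
    · exact (hpos h).le
    · rw [kelvin_of_powerFn_eq_zero he (powerFn_eq_zero he hτ h.symm), sub_self]
  -- `m` bounds the difference from below on the sphere `κ = 4`, which separates the annulus near
  -- the boundary from the region near infinity.
  obtain ⟨m, hm, hmin⟩ := (isCompact_ratioSq_mem_Icc e hτ 4 4).exists_forall_le'
    (f := fun y => U y - kelvin U e τ y) (a := 0)
    (fun z hz => (hU.continuous.continuousAt.sub (continuousAt_kelvin_right hU.continuous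
      (by linarith [hz.1]))).continuousWithinAt)
    (fun z hz => hpos (by linarith [hz.1]))
  have hmin' : ∀ y, ratioSq e τ y = 4 → m ≤ U y - kelvin U e τ y := fun y hy =>
    hmin y (by simp [hy])
  have h4 : (4 : ℝ) ^ weight n ≤ 1 := Real.rpow_le_one_of_one_le_of_nonpos (by norm_num) hα.le
  have h4' : (0 : ℝ) < 4 ^ weight n := by positivity
  refine ⟨m, hm, fun y hy => ?_, fun y hy => ?_⟩
  · have := annulus_comparison hU he hτ hS hD (a := m) (b := -m) le_rfl
      (fun z hz => by simpa using hnonneg hz.ge)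
      (fun z hz => by nlinarith [hmin' z hz]) hy
    linarith
  -- Subtracting `m k ^ α` makes the barrier vanish on the outer sphere `κ = k`; then `k → ∞`.
  · have key : ∀ k, ratioSq e τ y ≤ k →
        m * ratioSq e τ y ^ weight n - m * k ^ weight n ≤ U y - kelvin U e τ y := by
      intro k hk
      have hk4 : 4 ≤ k := hy.trans hk
      have hk0 : 0 ≤ k ^ weight n := by positivity
      have := annulus_comparison hU he hτ hS hD (a := -(m * k ^ weight n)) (b := m)
        (κ₁ := 4) (κ₂ := k) (by norm_num) (fun z hz => by nlinarith [hmin' z hz])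
        (fun z hz => by
          have := hnonneg (y := z) (by linarith)
          linarith) ⟨hy, hk⟩
      linarith
    have hlim : Tendsto (fun k : ℝ => m * ratioSq e τ y ^ weight n - m * k ^ weight n) atTop
        (𝓝 (m * ratioSq e τ y ^ weight n - m * 0)) := by
      have := tendsto_rpow_neg_atTop (y := -weight n) (by linarith)
      rw [neg_neg] at this
      exact tendsto_const_nhds.sub (this.const_mul m)
    rw [mul_zero, sub_zero] at hlim
    exact le_of_tendsto hlim ((eventually_ge_atTop _).mono key)

theorem nonneg_deriv_of_nonneg_right {f : ℝ → ℝ} {a b d : ℝ} (hab : a < b)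
    (hf : HasDerivAt f d a) (h0 : f a = 0) (h : ∀ s ∈ Ioo a b, 0 ≤ f s) : 0 ≤ d := by
  have h1 := (hasDerivWithinAt_iff_tendsto_slope' (s := Ioi a) (by simp)).mp hf.hasDerivWithinAt
  refine ge_of_tendsto h1 ?_
  filter_upwards [Ioo_mem_nhdsGT hab] with s hs
  rw [slope_def_field, h0, sub_zero]
  exact div_nonneg (h s hs) (sub_pos.mpr hs.1).le

theorem ratioSq_ray (e : EuclideanSpace ℝ (Fin n)) (hτ : 0 < τ) (y : EuclideanSpace ℝ (Fin n))
    (s : ℝ) : ratioSq e τ (τ⁻¹ • e + s • (y - τ⁻¹ • e)) = s ^ 2 * ratioSq e τ y := by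
  have : τ • (τ⁻¹ • e + s • (y - τ⁻¹ • e)) - e = s • (τ • y - e) := by
    simp only [smul_add, smul_sub, smul_smul]
    rw [mul_inv_cancel₀ hτ.ne', mul_left_comm, mul_inv_cancel₀ hτ.ne', mul_comm τ s]
    module
  rw [ratioSq, this, norm_smul, mul_pow, Real.norm_eq_abs, sq_abs, ratioSq]

theorem hasDerivAt_ray (hU : ContDiff ℝ 2 U) (x d : EuclideanSpace ℝ (Fin n)) (s : ℝ) :
    HasDerivAt (fun s : ℝ => U (x + s • d)) (fderiv ℝ U (x + s • d) d) s :=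
  ((hU.differentiable (by norm_num)) _).hasFDerivAt.comp_hasDerivAt s (hasDerivAt_line x d s)

/-- Hopf's lemma. On the ray from the centre through `y`, the difference minus the barrier `m (1 - s
^ (2α))` is nonnegative for `1 < s < 2` and vanishes at `s = 1`. Its derivative there is twice the
displayed quantity plus `2αm`, and `α < 0`. -/
theorem boundary_derivative_pos (hn : 3 ≤ n) (hU : ContDiff ℝ 2 U) (he : ‖e‖ = 1) (hτ : 0 < τ)
    (hS : SuperharmonicDiff U e τ) (hD : Dominates U e τ) {y : EuclideanSpace ℝ (Fin n)}
    (hy : ratioSq e τ y = 1) :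
    0 < -weight n * U y + fderiv ℝ U y (y - τ⁻¹ • e) := by
  obtain ⟨m, hm, hlow, -⟩ := exists_lower_bound hn hU he hτ hS hD
  have hα := weight_neg hn
  set d := y - τ⁻¹ • e with hd
  have hyd : τ⁻¹ • e + (1 : ℝ) • d = y := by rw [hd]; module
  set f : ℝ → ℝ := fun s => U (τ⁻¹ • e + s • d) - s ^ (2 * weight n) * U (τ⁻¹ • e + s⁻¹ • d) -
    m * (1 - s ^ (2 * weight n)) with hf
  have hp : HasDerivAt (fun s : ℝ => s ^ (2 * weight n)) (2 * weight n) 1 := by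
    simpa using Real.hasDerivAt_rpow_const (x := 1) (p := 2 * weight n) (Or.inl one_ne_zero)
  have h1 := hasDerivAt_ray hU (τ⁻¹ • e) d 1
  have hinv : HasDerivAt (fun s : ℝ => s⁻¹) (-1) 1 := by
    simpa using hasDerivAt_inv (one_ne_zero (α := ℝ))
  have h2 : HasDerivAt (fun s : ℝ => U (τ⁻¹ • e + s⁻¹ • d)) (-fderiv ℝ U y d) 1 := by
    have h := h1.scomp_of_eq (1 : ℝ) hinv (by simp)
    rw [hyd] at h
    exact h.congr_deriv (by simp)
  rw [hyd] at h1
  have hder := (h1.sub (hp.mul h2)).sub ((hp.const_sub 1).const_mul m)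
  have hnn := nonneg_deriv_of_nonneg_right (f := f) (b := 2) (by norm_num) hder
    (by simp [hf]) (fun s hs => by
      have hs0 : 0 < s := by linarith [hs.1]
      have hr : ratioSq e τ (τ⁻¹ • e + s • d) = s ^ 2 := by
        rw [hd, ratioSq_ray e hτ, hy, mul_one]
      have hr0 : 0 < ratioSq e τ (τ⁻¹ • e + s • d) := by rw [hr]; positivity
      have hpw : (s ^ 2) ^ weight n = s ^ (2 * weight n) := by
        rw [Real.rpow_mul hs0.le, Real.rpow_two]
      have hk : kelvin U e τ (τ⁻¹ • e + s • d) =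
          s ^ (2 * weight n) * U (τ⁻¹ • e + s⁻¹ • d) := by
        rw [kelvin, sphereInv_eq he hτ.ne' hr0, hr, hpw, add_sub_cancel_left, smul_smul]
        congr 4
        field_simp
      have := hlow (τ⁻¹ • e + s • d) (by
        rw [hr]; constructor <;> nlinarith [hs.1, hs.2])
      rw [hk, hr, hpw] at this
      simp only [hf]
      linarith)
  simp only [inv_one, Real.one_rpow, hyd] at hnn
  nlinarith [mul_pos hm (neg_pos.mpr hα)]

/-- A point and its image lie on one ray from the centre, at parameters `1` and `κ⁻¹`. The function
`s ^ (-α) * U` takes the values `U y` and `kelvin U e τ y` there, and the hypothesis says that it is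
nondecreasing in between. -/
theorem kelvin_le_of_radial_deriv (hU : ContDiff ℝ 2 U) (he : ‖e‖ = 1) (hτ : 0 < τ)
    {y : EuclideanSpace ℝ (Fin n)} (hy : 1 ≤ ratioSq e τ y)
    (h : ∀ s ∈ Icc (ratioSq e τ y)⁻¹ 1, 0 ≤ -weight n * U (τ⁻¹ • e + s • (y - τ⁻¹ • e)) +
      fderiv ℝ U (τ⁻¹ • e + s • (y - τ⁻¹ • e)) (s • (y - τ⁻¹ • e))) :
    kelvin U e τ y ≤ U y := by
  have hpos : 0 < ratioSq e τ y := by linarith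
  set d := y - τ⁻¹ • e with hd
  set ψ : ℝ → ℝ := fun s => s ^ (-weight n) * U (τ⁻¹ • e + s • d) with hψ
  have hinv : (ratioSq e τ y)⁻¹ ≤ 1 := inv_le_one_of_one_le₀ hy
  have hinv0 : 0 < (ratioSq e τ y)⁻¹ := inv_pos.mpr hpos
  have hder : ∀ s ∈ Icc (ratioSq e τ y)⁻¹ 1, HasDerivAt ψ (s ^ (-weight n - 1) *
      (-weight n * U (τ⁻¹ • e + s • d) + fderiv ℝ U (τ⁻¹ • e + s • d) (s • d))) s := by
    intro s hs
    have hs0 : 0 < s := hinv0.trans_le hs.1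
    have h1 := (Real.hasDerivAt_rpow_const (x := s) (p := -weight n) (Or.inl hs0.ne')).mul
      (hasDerivAt_ray hU (τ⁻¹ • e) d s)
    refine HasDerivAt.congr_deriv h1 ?_
    rw [map_smul, smul_eq_mul, Real.rpow_sub_one hs0.ne']
    field_simp
  have hmono : MonotoneOn ψ (Icc (ratioSq e τ y)⁻¹ 1) := by
    refine monotoneOn_of_deriv_nonneg (convex_Icc _ _)
      (fun s hs => (hder s hs).continuousAt.continuousWithinAt)
      (fun s hs => (hder s (interior_subset hs)).differentiableAt.differentiableWithinAt)
      (fun s hs => ?_)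
    have hs' := interior_subset hs
    rw [(hder s hs').deriv]
    have hs0 : 0 < s := hinv0.trans_le hs'.1
    exact mul_nonneg (by positivity) (h s hs')
  have h1 := hmono ⟨le_rfl, hinv⟩ ⟨hinv, le_rfl⟩ hinv
  have h2 : τ⁻¹ • e + (1 : ℝ) • d = y := by rw [hd]; module
  simp only [hψ, Real.one_rpow, one_mul, h2] at h1
  rwa [Real.inv_rpow hpos.le, Real.rpow_neg hpos.le, inv_inv, hd, ← sphereInv_eq he hτ.ne' hpos]
    at h1

end MovingSpheres

/-! ### Moving the spheres: openness, start and limit -/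

section MovingSpheres

variable {n : ℕ}

variable {U : EuclideanSpace ℝ (Fin n) → ℝ} {e : EuclideanSpace ℝ (Fin n)} {τ : ℝ}

theorem ray_mem_of_convex (he : ‖e‖ = 1) (hτ : 0 < τ) {y : EuclideanSpace ℝ (Fin n)}
    (hy : 1 ≤ ratioSq e τ y) {C : Set (EuclideanSpace ℝ (Fin n))} (hC : Convex ℝ C)
    (h1 : y ∈ C) (h2 : sphereInv e τ y ∈ C) {s : ℝ} (hs : s ∈ Icc (ratioSq e τ y)⁻¹ 1) :
    τ⁻¹ • e + s • (y - τ⁻¹ • e) ∈ C := by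
  have hpos : 0 < ratioSq e τ y := by linarith
  rw [sphereInv_eq he hτ.ne' hpos] at h2
  set k := (ratioSq e τ y)⁻¹
  rcases hs.1.eq_or_lt with h | h
  · rwa [← h]
  · have hk : 0 < 1 - k := by linarith [hs.2]
    have hmem := hC h2 h1 (a := (1 - s) / (1 - k)) (b := (s - k) / (1 - k))
      (div_nonneg (by linarith [hs.2]) hk.le) (div_nonneg (by linarith) hk.le)
      (by rw [← add_div, div_eq_one_iff_eq hk.ne']; ring)
    convert hmem using 1
    have h3 : (1 - s) / (1 - k) = 1 - (s - k) / (1 - k) := by field_simp; ring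
    have h4 : s = k + ((s - k) / (1 - k)) * (1 - k) := by field_simp; ring
    rw [h3]
    generalize (s - k) / (1 - k) = b at *
    rw [h4]
    module

/-- The strict Hopf inequality persists for nearby centres and points. Close to the sphere, a point
and its image lie in a common small ball, which by convexity contains the segment needed for
`kelvin_le_of_radial_deriv`. -/
theorem eventually_dominates_near_boundary (hn : 3 ≤ n) (hU : ContDiff ℝ 2 U) (he : ‖e‖ = 1)
    (hτ : 0 < τ) (hS : SuperharmonicDiff U e τ) (hD : Dominates U e τ)
    {y : EuclideanSpace ℝ (Fin n)} (hy : powerFn e τ y = 0) :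
    ∀ᶠ p : ℝ × EuclideanSpace ℝ (Fin n) in 𝓝 (τ, y),
      0 < powerFn e p.1 p.2 → kelvin U e p.1 p.2 ≤ U p.2 := by
  have hy1 : ratioSq e τ y = 1 := by rw [ratioSq_eq he, hy]; ring
  have hG := boundary_derivative_pos hn hU he hτ hS hD hy1
  have hfd : Continuous (fderiv ℝ U) := hU.continuous_fderiv (by norm_num)
  have hGc : ContinuousAt (fun p : ℝ × EuclideanSpace ℝ (Fin n) =>
      -weight n * U p.2 + fderiv ℝ U p.2 (p.2 - p.1⁻¹ • e)) (τ, y) := by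
    refine (continuousAt_const.mul (hU.continuous.comp continuous_snd).continuousAt).add ?_
    refine (hfd.comp continuous_snd).continuousAt.clm_apply ?_
    exact continuousAt_snd.sub ((continuousAt_fst.inv₀ hτ.ne').smul continuousAt_const)
  obtain ⟨ε, hε, hball⟩ := Metric.eventually_nhds_iff_ball.mp
    (hGc.eventually (lt_mem_nhds hG))
  have hinv : ContinuousAt (fun p : ℝ × EuclideanSpace ℝ (Fin n) => sphereInv e p.1 p.2) (τ, y) :=
    continuousAt_sphereInv (by simp [hy1])
  have hinv1 : Tendsto (fun p : ℝ × EuclideanSpace ℝ (Fin n) => sphereInv e p.1 p.2)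
      (𝓝 (τ, y)) (𝓝 y) := by
    have h := hinv.tendsto
    simp only [sphereInv_of_powerFn_eq_zero he hy] at h
    exact h
  filter_upwards [hinv1.eventually (Metric.ball_mem_nhds y hε), Metric.ball_mem_nhds (τ, y) hε,
    continuousAt_fst.eventually (lt_mem_nhds hτ)] with p hp1 hp2 hp3 hμ
  have hκ := ((one_lt_ratioSq_iff he hp3).mpr hμ).le
  rw [← ball_prod_same] at hp2
  refine kelvin_le_of_radial_deriv hU he hp3 hκ fun s hs => ?_
  have hz := ray_mem_of_convex he hp3 hκ (convex_ball y ε) hp2.2 hp1 hs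
  have h := hball (p.1, p.1⁻¹ • e + s • (p.2 - p.1⁻¹ • e))
    (by rw [← ball_prod_same]; exact ⟨hp2.1, hz⟩)
  simp only [add_sub_cancel_left] at h
  exact h.le

/-- In the inverted variable `ζ = y / ‖y‖ ^ 2`, the Kelvin transform is `‖y‖ ^ (2α) * A (t, ζ)` with
`A` continuous at `ζ = 0`. The lower bound at `τ` leaves a gap `m k ^ α` there, which absorbs a
small change of `t`. -/
theorem eventually_dominates_at_infinity (hn : 3 ≤ n) (hU : ContDiff ℝ 2 U) (he : ‖e‖ = 1)
    (hτ : 0 < τ) (hS : SuperharmonicDiff U e τ) (hD : Dominates U e τ) :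
    ∀ᶠ p : ℝ × EuclideanSpace ℝ (Fin n) in
      𝓝 τ ×ˢ Bornology.cobounded (EuclideanSpace ℝ (Fin n)), kelvin U e p.1 p.2 ≤ U p.2 := by
  obtain ⟨m, hm, -, hlow⟩ := exists_lower_bound hn hU he hτ hS hD
  set k : ℝ × EuclideanSpace ℝ (Fin n) → ℝ :=
    fun p => ‖p.2‖ ^ 2 + p.1 * (p.1 - 2 * inner ℝ e p.2) with hk
  set S : ℝ × EuclideanSpace ℝ (Fin n) → EuclideanSpace ℝ (Fin n) :=
    fun p => (k p)⁻¹ • (p.2 + (p.1 - 2 * inner ℝ e p.2) • e) with hSdef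
  have hkc : Continuous k := by simp only [hk]; fun_prop
  have hk0 : 0 < k (τ, 0) := by simp [hk]; positivity
  have hSc : ContinuousAt S (τ, 0) := by
    refine (hkc.continuousAt.inv₀ hk0.ne').smul (Continuous.continuousAt ?_)
    fun_prop
  have hchange : ∀ (t : ℝ) (y : EuclideanSpace ℝ (Fin n)), y ≠ 0 →
      ratioSq e t y = ‖y‖ ^ 2 * k (t, (‖y‖ ^ 2)⁻¹ • y) ∧
      sphereInv e t y = S (t, (‖y‖ ^ 2)⁻¹ • y) := by
    intro t y hy
    have hy' : ‖y‖ ≠ 0 := norm_ne_zero_iff.mpr hy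
    have h2 : powerFn e t y = ‖y‖ ^ 2 * (t - 2 * inner ℝ e ((‖y‖ ^ 2)⁻¹ • y)) := by
      rw [powerFn, inner_smul_right]; field_simp
    have h1 : ratioSq e t y = ‖y‖ ^ 2 * k (t, (‖y‖ ^ 2)⁻¹ • y) := by
      rw [ratioSq_eq he, h2]
      simp only [hk, norm_smul, norm_inv, norm_pow, norm_norm]
      field_simp
    refine ⟨h1, ?_⟩
    have h3 : ∀ b : ℝ, y + (‖y‖ ^ 2 * b) • e = ‖y‖ ^ 2 • ((‖y‖ ^ 2)⁻¹ • y + b • e) := fun b => by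
      rw [smul_add, smul_smul, mul_inv_cancel₀ (by positivity), one_smul, smul_smul]
    rw [sphereInv, h1, h2, h3, smul_smul, mul_inv, mul_right_comm,
      inv_mul_cancel₀ (by positivity), one_mul]
  set A : ℝ × EuclideanSpace ℝ (Fin n) → ℝ := fun p => k p ^ weight n * U (S p) with hA
  have hAc : ContinuousAt A (τ, 0) :=
    (hkc.continuousAt.rpow_const (Or.inl hk0.ne')).mul
      (ContinuousAt.comp hU.continuous.continuousAt hSc)
  set A' : ℝ × EuclideanSpace ℝ (Fin n) → ℝ := fun p =>
    k (τ, p.2) ^ weight n * U (S (τ, p.2)) + m * k (τ, p.2) ^ weight n with hA'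
  have hpr : ContinuousAt (fun p : ℝ × EuclideanSpace ℝ (Fin n) => (τ, p.2)) (τ, 0) := by fun_prop
  have hA'c : ContinuousAt A' (τ, 0) := by
    refine ContinuousAt.add (ContinuousAt.comp (g := A) hAc hpr) (continuousAt_const.mul ?_)
    exact ContinuousAt.comp (g := fun p => k p ^ weight n)
      (hkc.continuousAt.rpow_const (Or.inl hk0.ne')) hpr
  have hlt : A (τ, 0) < A' (τ, 0) := by
    simp only [hA, hA']
    have : 0 < m * k (τ, 0) ^ weight n := by positivity
    linarith
  have hζ : Tendsto (fun y : EuclideanSpace ℝ (Fin n) => (‖y‖ ^ 2)⁻¹ • y)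
      (Bornology.cobounded _) (𝓝 0) := by
    rw [tendsto_zero_iff_norm_tendsto_zero]
    have h1 : Tendsto (fun y : EuclideanSpace ℝ (Fin n) => ‖y‖⁻¹) (Bornology.cobounded _) (𝓝 0) :=
      tendsto_inv_atTop_zero.comp tendsto_norm_cobounded_atTop
    refine h1.congr fun y => ?_
    rw [norm_smul, norm_inv, norm_pow, norm_norm]
    by_cases hy : ‖y‖ = 0
    · simp [hy]
    · field_simp
  have hlim : Tendsto (fun p : ℝ × EuclideanSpace ℝ (Fin n) => (p.1, (‖p.2‖ ^ 2)⁻¹ • p.2))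
      (𝓝 τ ×ˢ Bornology.cobounded _) (𝓝 (τ, 0)) := by
    rw [nhds_prod_eq]
    exact tendsto_fst.prodMk (hζ.comp tendsto_snd)
  -- `‖y‖ ≥ 3 / τ` gives `‖τ • y - e‖ ≥ 2`, that is `κ ≥ 4`, where the lower bound at infinity
  -- applies.
  have hbig : ∀ᶠ p : ℝ × EuclideanSpace ℝ (Fin n) in
      𝓝 τ ×ˢ Bornology.cobounded (EuclideanSpace ℝ (Fin n)), 3 / τ ≤ ‖p.2‖ :=
    (tendsto_norm_cobounded_atTop.comp tendsto_snd).eventually_ge_atTop _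
  filter_upwards [hbig, hlim.eventually (hAc.eventually_lt hA'c hlt)] with p hp1 hp2
  obtain ⟨t, y⟩ := p
  simp only at hp1 hp2 ⊢
  have hy : y ≠ 0 := by
    rintro rfl
    rw [norm_zero] at hp1
    exact absurd hp1 (not_le.mpr (by positivity))
  have hy2 : (0 : ℝ) < ‖y‖ ^ 2 := by positivity
  have h4 : 4 ≤ ratioSq e τ y := by
    rw [div_le_iff₀' hτ] at hp1
    have h5 : ‖τ • y‖ ≤ ‖τ • y - e‖ + ‖e‖ := by simpa using norm_add_le (τ • y - e) e
    rw [norm_smul, Real.norm_eq_abs, abs_of_pos hτ, he] at h5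
    rw [ratioSq]
    nlinarith
  have h6 := hlow y h4
  obtain ⟨h7, h8⟩ := hchange τ y hy
  obtain ⟨h9, h10⟩ := hchange t y hy
  have hkτ : 0 ≤ k (τ, (‖y‖ ^ 2)⁻¹ • y) := by
    have : 0 ≤ ‖y‖ ^ 2 * k (τ, (‖y‖ ^ 2)⁻¹ • y) := by rw [← h7]; linarith
    exact nonneg_of_mul_nonneg_right this hy2
  have hkt : 0 ≤ k (t, (‖y‖ ^ 2)⁻¹ • y) := by
    have : 0 ≤ ‖y‖ ^ 2 * k (t, (‖y‖ ^ 2)⁻¹ • y) := by rw [← h9]; exact sq_nonneg _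
    exact nonneg_of_mul_nonneg_right this hy2
  rw [kelvin, h7, h8, Real.mul_rpow hy2.le hkτ] at h6
  rw [kelvin, h9, h10, Real.mul_rpow hy2.le hkt]
  have h11 : (‖y‖ ^ 2) ^ weight n * A (t, (‖y‖ ^ 2)⁻¹ • y) <
      (‖y‖ ^ 2) ^ weight n * A' (t, (‖y‖ ^ 2)⁻¹ • y) :=
    mul_lt_mul_of_pos_left hp2 (by positivity)
  simp only [hA, hA'] at h11
  nlinarith

theorem eventually_dominates (hn : 3 ≤ n) (hU : ContDiff ℝ 2 U) (he : ‖e‖ = 1)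
    (hτ : 0 < τ) (hS : SuperharmonicDiff U e τ) (hD : Dominates U e τ) :
    ∀ᶠ t in 𝓝 τ, Dominates U e t := by
  obtain ⟨P, hP, Q, hQ, hPQ⟩ := eventually_prod_iff.mp
    (eventually_dominates_at_infinity hn hU he hτ hS hD)
  obtain ⟨R, hR⟩ := (Metric.hasBasis_cobounded_compl_closedBall
    (0 : EuclideanSpace ℝ (Fin n))).eventually_iff.mp hQ
  have hcomp := (isCompact_closedBall (0 : EuclideanSpace ℝ (Fin n))
    R).eventually_forall_of_forall_eventually (x₀ := τ)
    (P := fun t y => 0 < powerFn e t y → kelvin U e t y ≤ U y) (fun y _ => by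
      rcases lt_trichotomy (powerFn e τ y) 0 with h | h | h
      · filter_upwards [((continuous_powerFn e).continuousAt (x := (τ, y))).eventually
          (gt_mem_nhds h)] with p hp hp'
        exact absurd hp' hp.not_gt
      · exact eventually_dominates_near_boundary hn hU he hτ hS hD h
      · have h1 : 0 < ratioSq e τ y := by
          linarith [(one_lt_ratioSq_iff he hτ).mpr h]
        filter_upwards [(continuousAt_kelvin (p := (τ, y)) hU.continuous h1).eventually_lt
          (hU.continuous.comp continuous_snd).continuousAt (kelvin_lt hU hS hD h)] with p hp _
        exact hp.le)
  filter_upwards [hcomp, hP] with t ht1 ht2 y hy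
  by_cases hyR : y ∈ Metric.closedBall (0 : EuclideanSpace ℝ (Fin n)) R
  · exact ht1 y hyR hy
  · exact hPQ ht2 (hR.2 hyR)

theorem dominates_of_eventually_right (hU : Continuous U) (he : ‖e‖ = 1) (hτ : 0 ≤ τ)
    (h : ∀ᶠ t in 𝓝[>] τ, Dominates U e t) : Dominates U e τ := by
  intro y hy
  have hκ : 0 < ratioSq e τ y := by rw [ratioSq_eq he]; positivity
  have h1 : ContinuousAt (fun t => kelvin U e t y) τ :=
    ContinuousAt.comp (f := fun t => (t, y)) (continuousAt_kelvin (p := (τ, y)) hU hκ)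
      (by fun_prop)
  have h2 : Continuous fun t => powerFn e t y := by unfold powerFn; fun_prop
  have h3 : Tendsto (fun t => kelvin U e t y) (𝓝[>] τ) (𝓝 (kelvin U e τ y)) :=
    h1.tendsto.mono_left nhdsWithin_le_nhds
  refine le_of_tendsto h3 ?_
  filter_upwards [h, nhdsWithin_le_nhds (h2.continuousAt.eventually (lt_mem_nhds hy))]
    with t ht1 ht2 using ht1 y ht2

/-- Within a fixed small distance `r` of the centre, the positive term `-α U` beats the radial
derivative. Farther out, the image point stays in the unit ball, so the Kelvin transform is at most
`C₀ (t ‖y - x‖) ^ (2α)`, which for large `t` lies below the assumed lower bound of the same decay.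
-/
theorem eventually_atTop_dominates (hn : 3 ≤ n) (hU : ContDiff ℝ 2 U) (hpos : ∀ y, 0 < U y)
    {c : ℝ} (hc : 0 < c) (hlow : ∀ y, c * ((‖y‖ ^ 2 + 1) / 2) ^ weight n ≤ U y) (he : ‖e‖ = 1) :
    ∀ᶠ t in atTop, Dominates U e t := by
  have hα := weight_neg hn
  have hK := isCompact_closedBall (0 : EuclideanSpace ℝ (Fin n)) 1
  have hfd : Continuous (fderiv ℝ U) := hU.continuous_fderiv (by norm_num)
  obtain ⟨c₁, hc₁, hmin⟩ := hK.exists_forall_le' hU.continuous.continuousOn (a := 0)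
    (fun y _ => hpos y)
  obtain ⟨C, hC⟩ := hK.exists_bound_of_continuousOn hfd.continuousOn
  obtain ⟨C₀, hC₀⟩ := hK.exists_bound_of_continuousOn hU.continuous.continuousOn
  have hCnn : 0 ≤ C := (norm_nonneg _).trans (hC 0 (by simp))
  obtain ⟨r, hr0, hr1, hrC⟩ : ∃ r : ℝ, 0 < r ∧ r ≤ 1 / 2 ∧ C * r ≤ -weight n * c₁ := by
    have hb : 0 < -weight n * c₁ / (C + 1) := by
      have : 0 < -weight n * c₁ := mul_pos (by linarith) hc₁
      positivity
    refine ⟨min (1 / 2) (-weight n * c₁ / (C + 1)), lt_min (by norm_num) hb, min_le_left _ _, ?_⟩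
    have h1 : min (1 / 2) (-weight n * c₁ / (C + 1)) * (C + 1) ≤ -weight n * c₁ := by
      rw [← le_div_iff₀ (by linarith)]; exact min_le_right _ _
    nlinarith [lt_min (by norm_num : (0 : ℝ) < 1 / 2) hb]
  -- Chosen so that `(‖y‖ ^ 2 + 1) / 2 ≤ A ‖y - x‖ ^ 2` once `‖y - x‖ > r`, using `‖x‖ ≤ r / 2`.
  set A := (4 + 1 / r ^ 2) / 2 with hA
  have hA0 : 0 < A := by positivity
  have hlim : Tendsto (fun t : ℝ => C₀ * (t ^ 2) ^ weight n) atTop (𝓝 (C₀ * 0)) := by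
    have h1 := (tendsto_rpow_neg_atTop (y := -weight n) (by linarith)).comp
      (tendsto_pow_atTop (α := ℝ) two_ne_zero)
    rw [neg_neg] at h1
    exact h1.const_mul C₀
  rw [mul_zero] at hlim
  have hsmall := hlim.eventually (gt_mem_nhds (show 0 < c * A ^ weight n by positivity))
  filter_upwards [hsmall, eventually_ge_atTop (2 / r)] with t ht1 ht2 y hy
  have ht : 0 < t := lt_of_lt_of_le (by positivity) ht2
  have hκ := (one_lt_ratioSq_iff he ht).mpr hy
  have hκ0 : 0 < ratioSq e t y := by linarith
  have hx : ‖t⁻¹ • e‖ ≤ r / 2 := by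
    rw [norm_smul, he, mul_one, norm_inv, Real.norm_eq_abs, abs_of_pos ht, inv_le_comm₀ ht
      (by positivity), inv_div]
    exact ht2
  set x := t⁻¹ • e with hxdef
  have hκx : ratioSq e t y = t ^ 2 * ‖y - x‖ ^ 2 := by
    have : t • y - e = t • (y - x) := by
      rw [hxdef, smul_sub, smul_smul, mul_inv_cancel₀ ht.ne', one_smul]
    rw [ratioSq, this, norm_smul, mul_pow, Real.norm_eq_abs, sq_abs]
  rcases le_or_gt ‖y - x‖ r with hyr | hyr
  · refine kelvin_le_of_radial_deriv hU he ht hκ.le fun s hs => ?_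
    have hs0 : 0 ≤ s := (inv_pos.mpr hκ0).le.trans hs.1
    have h1 : ‖s • (y - x)‖ ≤ r := by
      rw [norm_smul, Real.norm_eq_abs, abs_of_nonneg hs0]
      nlinarith [hs.2, norm_nonneg (y - x)]
    have h2 : x + s • (y - x) ∈ Metric.closedBall (0 : EuclideanSpace ℝ (Fin n)) 1 := by
      rw [mem_closedBall_zero_iff]
      linarith [norm_add_le x (s • (y - x))]
    have h3 := hmin _ h2
    have h4 := (fderiv ℝ U (x + s • (y - x))).le_opNorm (s • (y - x))
    have h5 := hC _ h2
    have h6 : ‖fderiv ℝ U (x + s • (y - x)) (s • (y - x))‖ ≤ C * r :=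
      h4.trans (mul_le_mul h5 h1 (norm_nonneg _) hCnn)
    have h7 := neg_le_of_abs_le (Real.norm_eq_abs _ ▸ h6)
    nlinarith
  · have hinv : ‖sphereInv e t y‖ ≤ 1 := by
      have h1 : ‖(ratioSq e t y)⁻¹ • (y - x)‖ ≤ r / 2 := by
        have h2 : 0 < ‖y - x‖ := hr0.trans hyr
        rw [norm_smul, norm_inv, Real.norm_eq_abs, abs_of_pos hκ0, inv_mul_le_iff₀ hκ0, hκx]
        have h3 : 2 ≤ t * r := by rwa [div_le_iff₀ hr0] at ht2
        have h4 : 1 ≤ t * ‖y - x‖ := by nlinarith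
        have h5 : 4 ≤ t ^ 2 * ‖y - x‖ * r := by nlinarith
        nlinarith
      rw [sphereInv_eq he ht.ne' hκ0]
      linarith [norm_add_le x ((ratioSq e t y)⁻¹ • (y - x))]
    have h1 : U (sphereInv e t y) ≤ C₀ :=
      (le_abs_self _).trans (hC₀ _ (mem_closedBall_zero_iff.mpr hinv))
    have h2 : (‖y‖ ^ 2 + 1) / 2 ≤ A * ‖y - x‖ ^ 2 := by
      have h3 : ‖y‖ ≤ 2 * ‖y - x‖ := by
        have := norm_add_le (y - x) x
        rw [sub_add_cancel] at this
        linarith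
      have h4 : 1 ≤ 1 / r ^ 2 * ‖y - x‖ ^ 2 := by
        rw [one_div, ← div_eq_inv_mul, one_le_div (by positivity)]
        gcongr
      rw [hA]
      nlinarith [norm_nonneg y, norm_nonneg (y - x)]
    have hd0 : 0 < ‖y - x‖ := hr0.trans hyr
    calc kelvin U e t y = (t ^ 2) ^ weight n * (‖y - x‖ ^ 2) ^ weight n *
          U (sphereInv e t y) := by
          rw [kelvin, hκx, Real.mul_rpow (by positivity) (by positivity)]
      _ ≤ (t ^ 2) ^ weight n * (‖y - x‖ ^ 2) ^ weight n * C₀ := by gcongr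
      _ = (C₀ * (t ^ 2) ^ weight n) * (‖y - x‖ ^ 2) ^ weight n := by ring
      _ ≤ (c * A ^ weight n) * (‖y - x‖ ^ 2) ^ weight n := by gcongr
      _ = c * (A * ‖y - x‖ ^ 2) ^ weight n := by
          rw [Real.mul_rpow hA0.le (by positivity), mul_assoc]
      _ ≤ c * ((‖y‖ ^ 2 + 1) / 2) ^ weight n := by
          gcongr ?_ * ?_
          exact Real.rpow_le_rpow_of_nonpos (by positivity) h2 hα.le
      _ ≤ U y := hlow y

/-- At the supremum of the failing parameters domination holds as a limit from the right. Openness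
then excludes failures just below, contradicting the supremum. -/
theorem dominates_of_superharmonicDiff (hn : 3 ≤ n) (hU : ContDiff ℝ 2 U) (hpos : ∀ y, 0 < U y)
    {c : ℝ} (hc : 0 < c) (hlow : ∀ y, c * ((‖y‖ ^ 2 + 1) / 2) ^ weight n ≤ U y) (he : ‖e‖ = 1)
    (hS : ∀ t, 0 < t → SuperharmonicDiff U e t) (hτ : 0 < τ) : Dominates U e τ := by
  by_contra hneg
  set B := {t : ℝ | 0 < t ∧ ¬ Dominates U e t} with hB
  obtain ⟨T, hT⟩ := eventually_atTop.mp (eventually_atTop_dominates hn hU hpos hc hlow he)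
  have hbdd : BddAbove B := ⟨T, fun t ht => le_of_not_ge fun h => ht.2 (hT t h)⟩
  have hne : B.Nonempty := ⟨τ, hτ, hneg⟩
  have hσ : 0 < sSup B := hτ.trans_le (le_csSup hbdd ⟨hτ, hneg⟩)
  have hright : ∀ t, sSup B < t → Dominates U e t := fun t ht => by
    by_contra h
    exact absurd (le_csSup hbdd ⟨hσ.trans ht, h⟩) (not_le.mpr ht)
  have hD : Dominates U e (sSup B) :=
    dominates_of_eventually_right hU.continuous he hσ.le
      (eventually_nhdsWithin_of_forall hright)
  obtain ⟨ε, hε, hball⟩ := Metric.eventually_nhds_iff_ball.mp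
    (eventually_dominates hn hU he hσ (hS _ hσ) hD)
  obtain ⟨t, htB, ht⟩ := exists_lt_of_lt_csSup hne (sub_lt_self (sSup B) hε)
  refine htB.2 (hball t ?_)
  rw [Metric.mem_ball, Real.dist_eq, abs_lt]
  constructor <;> linarith [le_csSup hbdd htB]

/-- With `e` along `z - y` and `τ → 0`, the inversion becomes the reflection that exchanges `y` and
`z`. Domination gives one inequality, and exchanging roles the other. -/
theorem eq_of_norm_eq_of_superharmonicDiff (hn : 3 ≤ n) (hU : ContDiff ℝ 2 U)
    (hpos : ∀ y, 0 < U y) {c : ℝ} (hc : 0 < c)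
    (hlow : ∀ y, c * ((‖y‖ ^ 2 + 1) / 2) ^ weight n ≤ U y)
    (hS : ∀ e : EuclideanSpace ℝ (Fin n), ‖e‖ = 1 → ∀ t, 0 < t → SuperharmonicDiff U e t)
    {y z : EuclideanSpace ℝ (Fin n)} (hyz : ‖y‖ = ‖z‖) : U y = U z := by
  have key : ∀ y z : EuclideanSpace ℝ (Fin n), ‖y‖ = ‖z‖ → U z ≤ U y := by
    intro y z hyz
    rcases eq_or_ne y z with rfl | hne
    · exact le_rfl
    have hd : 0 < ‖z - y‖ := norm_pos_iff.mpr (sub_ne_zero.mpr hne.symm)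
    set e := ‖z - y‖⁻¹ • (z - y) with hedef
    have he : ‖e‖ = 1 := by
      rw [hedef, norm_smul, norm_inv, norm_norm, inv_mul_cancel₀ hd.ne']
    have hsq : ‖z - y‖ ^ 2 = 2 * ‖y‖ ^ 2 - 2 * inner ℝ z y := by
      rw [norm_sub_sq_real, hyz]; ring
    have hin : inner ℝ e y = -(‖z - y‖ / 2) := by
      rw [hedef, real_inner_smul_left, inner_sub_left, real_inner_self_eq_norm_sq]
      field_simp
      linarith
    have hD : Dominates U e 0 := by
      refine dominates_of_eventually_right hU.continuous he le_rfl ?_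
      filter_upwards [self_mem_nhdsWithin] with t ht
      exact dominates_of_superharmonicDiff hn hU hpos hc hlow he (hS e he) ht
    have h := hD y (by rw [powerFn, hin]; linarith)
    have hr : ratioSq e 0 y = 1 := by simp [ratioSq, he]
    have hz : sphereInv e 0 y = z := by
      rw [sphereInv, hr, powerFn, hin, hedef, smul_smul]
      have : (0 * ‖y‖ ^ 2 - 2 * -(‖z - y‖ / 2)) * ‖z - y‖⁻¹ = 1 := by field_simp; ring
      rw [this]
      simp
    rwa [kelvin, hr, hz, Real.one_rpow, one_mul] at h
  exact le_antisymm (key z y hyz.symm) (key y z hyz)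

end MovingSpheres

/-! ### Rotations about the axis and meridians -/

section Rotations

variable {n : ℕ}

theorem inner_north (x : EuclideanSpace ℝ (Fin (n + 1))) :
    inner ℝ x (pole n) = x (Fin.last n) := by
  simp [pole, EuclideanSpace.inner_single_right]

theorem height_le_one (θ : Sph n) : height θ ≤ 1 := by
  have h := real_inner_le_norm (θ : EuclideanSpace ℝ (Fin (n + 1))) (pole n)
  rw [inner_north, sph_norm, ← coe_north, sph_norm] at h
  simpa [height] using h

theorem height_south : height (south n) = -1 := by simp [height, south, north]

theorem neg_one_le_height (θ : Sph n) : -1 ≤ height θ := by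
  have h : -height θ ≤ 1 := height_le_one (-θ)
  linarith

theorem height_lt_one {θ : Sph n} (hθ : θ ≠ north n) : height θ < 1 := by
  refine lt_of_le_of_ne (height_le_one θ) fun h => hθ (Subtype.ext ?_)
  rw [coe_north, ← inner_eq_one_iff_of_norm_eq_one (𝕜 := ℝ) (sph_norm θ)
    (by rw [← coe_north, sph_norm]), inner_north]
  exact h

/-- The reflection exchanging the two points fixes the axis, which is orthogonal to their
difference. -/
theorem exists_isometry_of_height_eq {θ θ' : Sph n} (h : height θ = height θ') :
    ∃ R : EuclideanSpace ℝ (Fin (n + 1)) ≃ₗᵢ[ℝ] EuclideanSpace ℝ (Fin (n + 1)),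
      isometryAct R (north n) = north n ∧ isometryAct R θ = θ' := by
  refine ⟨(ℝ ∙ ((θ : EuclideanSpace ℝ (Fin (n + 1))) - θ'))ᗮ.reflection, Subtype.ext ?_,
    Subtype.ext ?_⟩
  · change (ℝ ∙ ((θ : EuclideanSpace ℝ (Fin (n + 1))) - θ'))ᗮ.reflection (pole n) = pole n
    rw [Submodule.reflection_eq_self_iff, Submodule.mem_orthogonal_singleton_iff_inner_right,
      inner_north]
    simpa [height, sub_eq_zero] using h
  · exact Submodule.reflection_sub (by rw [sph_norm, sph_norm])

theorem RotationallySymmetric.eq_of_height_eq {f : Sph n → ℝ} (hf : RotationallySymmetric f)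
    {θ θ' : Sph n} (hθ : θ ≠ north n) (h : height θ = height θ') : f θ' = f θ := by
  obtain ⟨R, hR, rfl⟩ := exists_isometry_of_height_eq h
  exact hf R hR θ hθ

theorem height_isometryAct
    {R : EuclideanSpace ℝ (Fin (n + 1)) ≃ₗᵢ[ℝ] EuclideanSpace ℝ (Fin (n + 1))}
    (hR : isometryAct R (north n) = north n) (θ : Sph n) :
    height (isometryAct R θ) = height θ := by
  have h1 : R (pole n) = pole n := congrArg Subtype.val hR
  have h2 : inner ℝ (R θ) (pole n) = inner ℝ (θ : EuclideanSpace ℝ (Fin (n + 1))) (pole n) := by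
    conv_lhs => rw [← h1]
    exact R.inner_map_map _ _
  rwa [inner_north, inner_north] at h2

theorem exists_onCommonPolarGeodesic {θ : Sph n} (h1 : -1 < height θ) (h2 : height θ < 1) {c : ℝ}
    (hc1 : -1 ≤ c) (hc2 : c ≤ 1) : ∃ θ' : Sph n, height θ' = c ∧ OnCommonPolarGeodesic θ θ' := by
  have hs : 0 < 1 - height θ ^ 2 := by nlinarith
  set x : EuclideanSpace ℝ (Fin (n + 1)) := θ.1
  have hxx : inner ℝ x x = (1 : ℝ) := by rw [real_inner_self_eq_norm_sq, sph_norm]; norm_num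
  have hpp : inner ℝ (pole n) (pole n) = (1 : ℝ) := by rw [inner_north, pole_last]
  have hxp : inner ℝ x (pole n) = height θ := inner_north x
  have hpx : inner ℝ (pole n) x = height θ := by rw [real_inner_comm, hxp]
  set w := x - height θ • pole n with hw
  have hwn : ‖w‖ ^ 2 = 1 - height θ ^ 2 := by
    rw [← real_inner_self_eq_norm_sq, hw]
    simp only [inner_sub_left, inner_sub_right, real_inner_smul_left, real_inner_smul_right, hxx,
      hpp, hxp, hpx]
    ring
  have hwr : ‖w‖ = √(1 - height θ ^ 2) := by rw [← hwn, Real.sqrt_sq (norm_nonneg _)]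
  have hw0 : w ≠ 0 := by
    rw [← norm_ne_zero_iff]
    intro h
    rw [h] at hwn
    linarith
  have hwp : inner ℝ w (pole n) = (0 : ℝ) := by
    rw [hw, inner_sub_left, real_inner_smul_left, hxp, hpp]; ring
  have hep : inner ℝ (proj w hw0 : EuclideanSpace ℝ (Fin (n + 1))) (pole n) = (0 : ℝ) := by
    simp [proj, real_inner_smul_left, hwp]
  have hmem : Real.cos (Real.arccos c) • pole n + Real.sin (Real.arccos c) •
      (proj w hw0 : EuclideanSpace ℝ (Fin (n + 1))) ∈
      Metric.sphere (0 : EuclideanSpace ℝ (Fin (n + 1))) 1 := by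
    rw [mem_sphere_zero_iff_norm, ← sq_eq_sq₀ (norm_nonneg _) zero_le_one,
      ← real_inner_self_eq_norm_sq]
    have hpe : inner ℝ (pole n) (proj w hw0 : EuclideanSpace ℝ (Fin (n + 1))) = (0 : ℝ) := by
      rw [real_inner_comm, hep]
    have hee : inner ℝ (proj w hw0 : EuclideanSpace ℝ (Fin (n + 1))) (proj w hw0) = (1 : ℝ) := by
      rw [real_inner_self_eq_norm_sq, sph_norm]; norm_num
    simp only [inner_add_left, inner_add_right, real_inner_smul_left, real_inner_smul_right, hpp,
      hep, hpe, hee]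
    linarith [Real.sin_sq_add_cos_sq (Real.arccos c)]
  refine ⟨⟨_, hmem⟩, ?_, proj w hw0, ?_, Real.arccos (height θ), Real.arccos c, ?_, rfl⟩
  · rw [height, ← inner_north]
    simp only [inner_add_left, real_inner_smul_left, hpp, hep, Real.cos_arccos hc1 hc2]
    ring
  · rw [height, ← inner_north, hep]
  · rw [Real.cos_arccos h1.le h2.le, Real.sin_arccos, ← hwr, norm_smul_proj, coe_north, hw]
    module

/-- By symmetry `θ'` may be moved at constant height onto the meridian of `θ`, where the
monotonicity along geodesics applies. -/
theorem lt_of_height_lt {g : Sph n → ℝ} (g1 : RotationallySymmetric g)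
    (g2 : ∀ θ θ' : Sph n, θ ≠ north n → θ' ≠ north n → OnCommonPolarGeodesic θ θ' →
      height θ' < height θ → g θ' < g θ)
    {θ θ' : Sph n} (hθ : θ ≠ north n) (hθ' : θ' ≠ north n) (h : height θ' < height θ) :
    g θ' < g θ := by
  obtain ⟨θ₁, h1, h2⟩ := exists_onCommonPolarGeodesic
    ((neg_one_le_height θ').trans_lt h) (height_lt_one hθ) (neg_one_le_height θ')
    (height_le_one θ')
  rw [← g1.eq_of_height_eq hθ' h1.symm]
  refine g2 θ θ₁ hθ ?_ h2 (h1 ▸ h)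
  rintro rfl
  rw [height_north] at h1
  linarith [height_lt_one hθ']

end Rotations

/-! ### The nonlinearity and the passage to `ℝ^n` -/

section Reduction

variable {n : ℕ} {g : Sph n → ℝ → ℝ} {v : Sph n → ℝ}

/-- Let `s` be the value of `v` at the direction of `q`, and let `s' = (‖q‖ / ‖p‖) ^ α * s ≤ s`. The
exponent in (g3) is such that passing from `s` to `s'` trades the factor `‖q‖ ^ (α - 2)` for `‖p‖ ^
(α - 2)`. Then (g1) and (g2) raise the point strictly at the value `s'`, and (g4) raises `s'` to the
value of `v` at `p`, since `V q ≤ V p` means exactly that. No sign of `g` is needed. -/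
theorem laplacian_confExtension_lt (hn : 3 ≤ n)
    (g1 : ∀ s : ℝ, 0 < s → RotationallySymmetric (fun θ => g θ s))
    (g2 : ∀ s : ℝ, 0 < s → ∀ θ θ' : Sph n, θ ≠ north n → θ' ≠ north n →
      OnCommonPolarGeodesic θ θ' → height θ' < height θ → g θ' s < g θ s)
    (g3 : ∀ θ : Sph n, θ ≠ north n → θ ≠ south n →
      AntitoneOn (fun s : ℝ => s ^ (-(((n : ℝ) + 2) / ((n : ℝ) - 2))) * g θ s) (Ioi 0))
    (g4 : ∀ θ : Sph n, θ ≠ north n → θ ≠ south n → MonotoneOn (fun s : ℝ => g θ s) (Ioi 0))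
    (hv_smooth : ContMDiffOn (𝓡 n) 𝓘(ℝ, ℝ) 2 v {north n}ᶜ)
    (hv_pos : ∀ θ : Sph n, θ ≠ north n → 0 < v θ)
    (hv_eq : ∀ θ : Sph n, θ ≠ north n → -conformalLaplacian v θ = g θ (v θ))
    {p q : EuclideanSpace ℝ (Fin (n + 1))} (hp : p ≠ 0) (hq : q ≠ 0)
    (hpN : proj p hp ≠ north n) (hqN : proj q hq ≠ north n)
    (hqS : proj q hq ≠ south n) (hh : height (proj q hq) < height (proj p hp))
    (hpq : ‖p‖ ≤ ‖q‖) (hV : confExtension v q ≤ confExtension v p) :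
    (Δ (confExtension v)) p < (Δ (confExtension v)) q := by
  have hα := weight_neg hn
  have hp0 : 0 < ‖p‖ := norm_pos_iff.mpr hp
  have hq0 : 0 < ‖q‖ := norm_pos_iff.mpr hq
  have hpS : proj p hp ≠ south n := by
    intro h
    rw [h, height_south] at hh
    linarith [neg_one_le_height (proj q hq)]
  rw [laplacian_confExtension hv_smooth hp hpN, laplacian_confExtension hv_smooth hq hqN]
  have hep := hv_eq _ hpN
  have heq := hv_eq _ hqN
  rw [confExtension_of_ne v hp, confExtension_of_ne v hq] at hV
  have hvp := hv_pos _ hpN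
  have hvq := hv_pos _ hqN
  set P := ‖p‖ ^ weight n with hP
  set Q := ‖q‖ ^ weight n with hQ
  have hP0 : 0 < P := by positivity
  have hQ0 : 0 < Q := by positivity
  have hQP : Q ≤ P := Real.rpow_le_rpow_of_nonpos hp0 hpq hα.le
  set s := v (proj q hq)
  set s' := Q / P * s with hs'
  have hs'0 : 0 < s' := by positivity
  have hs's : s' ≤ s := by
    have : Q / P ≤ 1 := (div_le_one hP0).mpr hQP
    nlinarith
  have hs'v : s' ≤ v (proj p hp) := by
    rw [hs', div_mul_eq_mul_div, div_le_iff₀ hP0]; linarith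
  have h1 : g (proj q hq) s' < g (proj p hp) s' :=
    lt_of_height_lt (g1 s' hs'0) (g2 s' hs'0) hpN hqN hh
  have h2 : g (proj p hp) s' ≤ g (proj p hp) (v (proj p hp)) := g4 _ hpN hpS hs'0 hvp hs'v
  have h3 := g3 _ hqN hqS hs'0 hvq hs's
  simp only at h3
  set β := -(((n : ℝ) + 2) / ((n : ℝ) - 2)) with hβ
  have hn2 : (n : ℝ) - 2 ≠ 0 := by
    have : (3 : ℝ) ≤ n := by exact_mod_cast hn
    linarith
  have hαβ : weight n * -β = weight n - 2 := by
    rw [hβ, weight]; field_simp; ring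
  clear_value β
  have h4 : s' ^ β = (‖q‖ ^ (weight n - 2))⁻¹ * ‖p‖ ^ (weight n - 2) * s ^ β := by
    rw [hs', Real.mul_rpow (by positivity) hvq.le, Real.div_rpow hQ0.le hP0.le, hQ, hP,
      ← Real.rpow_mul hq0.le, ← Real.rpow_mul hp0.le, ← hαβ, mul_neg, Real.rpow_neg hq0.le,
      Real.rpow_neg hp0.le, inv_inv, div_eq_mul_inv]
  have hsβ : 0 < s ^ β := by positivity
  have hqa : 0 < ‖q‖ ^ (weight n - 2) := by positivity
  have hpa : 0 < ‖p‖ ^ (weight n - 2) := by positivity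
  have h5 : ‖q‖ ^ (weight n - 2) * g (proj q hq) s ≤
      ‖p‖ ^ (weight n - 2) * g (proj q hq) s' := by
    rw [h4] at h3
    refine le_of_mul_le_mul_left ?_ hsβ
    calc s ^ β * (‖q‖ ^ (weight n - 2) * g (proj q hq) s)
        = ‖q‖ ^ (weight n - 2) * (s ^ β * g (proj q hq) s) := by ring
      _ ≤ ‖q‖ ^ (weight n - 2) * ((‖q‖ ^ (weight n - 2))⁻¹ * ‖p‖ ^ (weight n - 2) * s ^ β *
          g (proj q hq) s') := mul_le_mul_of_nonneg_left h3 hqa.le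
      _ = ‖q‖ ^ (weight n - 2) * (‖q‖ ^ (weight n - 2))⁻¹ *
          (s ^ β * (‖p‖ ^ (weight n - 2) * g (proj q hq) s')) := by ring
      _ = s ^ β * (‖p‖ ^ (weight n - 2) * g (proj q hq) s') := by
          rw [mul_inv_cancel₀ hqa.ne', one_mul]
  have h7 : ‖p‖ ^ (weight n - 2) * g (proj q hq) s' <
      ‖p‖ ^ (weight n - 2) * g (proj p hp) (v (proj p hp)) :=
    mul_lt_mul_of_pos_left (h1.trans_le h2) hpa
  rw [← hep] at h7
  rw [← heq] at h5
  linarith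

/-- The liminf gives a bound near the pole, and compactness of the complement of a neighbourhood
gives one elsewhere. -/
theorem exists_pos_le_of_liminf
    (hv_cont : ContinuousOn v {north n}ᶜ) (hv_pos : ∀ θ : Sph n, θ ≠ north n → 0 < v θ)
    (hv_liminf : 0 < liminf (fun θ => ((v θ : ℝ) : EReal)) (𝓝[≠] north n)) :
    ∃ c : ℝ, 0 < c ∧ ∀ θ : Sph n, θ ≠ north n → c ≤ v θ := by
  obtain ⟨c₁, hc₁, hc₁'⟩ := EReal.lt_iff_exists_real_btwn.mp hv_liminf
  have hev := eventually_lt_of_lt_liminf hc₁'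
  rw [eventually_nhdsWithin_iff, eventually_nhds_iff] at hev
  obtain ⟨O, hO, hOo, hON⟩ := hev
  have hK : IsCompact Oᶜ := hOo.isClosed_compl.isCompact
  have hne : ∀ θ ∈ Oᶜ, θ ≠ north n := fun θ hθ h => hθ (h ▸ hON)
  obtain ⟨c₂, hc₂, hc₂'⟩ := hK.exists_forall_le' (hv_cont.mono hne) (a := 0)
    (fun θ hθ => hv_pos θ (hne θ hθ))
  refine ⟨min c₁ c₂, lt_min (by exact_mod_cast hc₁) hc₂, fun θ hθ => ?_⟩
  by_cases h : θ ∈ O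
  · exact (min_le_left _ _).trans (by exact_mod_cast (hO θ h hθ).le)
  · exact (min_le_right _ _).trans (hc₂' θ h)

theorem confExtension_stereo (y : EuclideanSpace ℝ (Fin n)) :
    confExtension v (stereo y) =
      ((‖y‖ ^ 2 + 1) / 2) ^ weight n * v (proj (stereo y) (stereo_ne_zero y)) := by
  rw [confExtension_of_ne v (stereo_ne_zero y), norm_stereo]

theorem confExtension_stereoInv {e : EuclideanSpace ℝ (Fin n)} (he : ‖e‖ = 1) {τ : ℝ}
    {y : EuclideanSpace ℝ (Fin n)} (h : 0 < ratioSq e τ y) :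
    confExtension v (stereoInv e τ y) = kelvin (fun y => confExtension v (stereo y)) e τ y := by
  rw [stereoInv_eq_smul he h, confExtension_smul v _ h, kelvin]

theorem exists_smul_stereo {θ : Sph n} (hθ : θ ≠ north n) :
    ∃ y : EuclideanSpace ℝ (Fin n), proj (stereo y) (stereo_ne_zero y) = θ := by
  have hh := height_lt_one hθ
  have hd : 0 < 1 - height θ := by linarith
  have hsum : ∑ i : Fin n, (θ : EuclideanSpace ℝ (Fin (n + 1))) i.castSucc ^ 2 +
      height θ ^ 2 = 1 := by
    have h := EuclideanSpace.norm_sq_eq (θ : EuclideanSpace ℝ (Fin (n + 1)))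
    rw [sph_norm, Fin.sum_univ_castSucc] at h
    simpa [height] using h.symm
  set y : EuclideanSpace ℝ (Fin n) := (1 - height θ)⁻¹ •
    WithLp.toLp 2 (fun i : Fin n => (θ : EuclideanSpace ℝ (Fin (n + 1))) i.castSucc) with hy
  have hyn : ‖y‖ ^ 2 = (1 + height θ) / (1 - height θ) := by
    rw [hy, norm_smul, mul_pow, EuclideanSpace.norm_sq_eq, Real.norm_eq_abs, sq_abs]
    simp only [Real.norm_eq_abs, sq_abs]
    rw [eq_sub_of_add_eq hsum]
    field_simp
    ring
  have hst : stereo y = (1 - height θ)⁻¹ • (θ : EuclideanSpace ℝ (Fin (n + 1))) := by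
    ext j
    refine Fin.lastCases ?_ (fun k => ?_) j
    · rw [stereo, incl_add_last, hyn]
      change _ = (1 - height θ)⁻¹ * height θ
      field_simp
      ring
    · simp [stereo, hy]
  refine ⟨y, Subtype.ext ?_⟩
  simp only [proj, hst, norm_smul, sph_norm, norm_inv, Real.norm_eq_abs, abs_of_pos hd, smul_smul]
  rw [mul_one, inv_inv, mul_inv_cancel₀ hd.ne', one_smul]

end Reduction

end SphereSymmetry

end

theorem theorem1p4 (n : ℕ) (hn : 3 ≤ n)
    (g : SphereSymmetry.Sph n → ℝ → ℝ)
    (hg_cont : ContinuousOn (fun p : SphereSymmetry.Sph n × ℝ => g p.1 p.2)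
      ({SphereSymmetry.north n}ᶜ ×ˢ Ioi (0 : ℝ)))
    (hg_bdd : ∀ s : ℝ, 0 < s → BddBelow ((fun θ => g θ s) '' {SphereSymmetry.north n}ᶜ))
    (g1 : ∀ s : ℝ, 0 < s → SphereSymmetry.RotationallySymmetric (fun θ => g θ s))
    (g2 : ∀ s : ℝ, 0 < s → ∀ θ θ' : SphereSymmetry.Sph n,
      θ ≠ SphereSymmetry.north n → θ' ≠ SphereSymmetry.north n →
      SphereSymmetry.OnCommonPolarGeodesic θ θ' →
      SphereSymmetry.height θ' < SphereSymmetry.height θ → g θ' s < g θ s)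
    (g3 : ∀ θ : SphereSymmetry.Sph n,
      θ ≠ SphereSymmetry.north n → θ ≠ SphereSymmetry.south n →
      AntitoneOn (fun s : ℝ => s ^ (-(((n : ℝ) + 2) / ((n : ℝ) - 2))) * g θ s) (Ioi 0))
    (g4 : ∀ θ : SphereSymmetry.Sph n,
      θ ≠ SphereSymmetry.north n → θ ≠ SphereSymmetry.south n →
      MonotoneOn (fun s : ℝ => g θ s) (Ioi 0))
    (v : SphereSymmetry.Sph n → ℝ)
    (hv_smooth : ContMDiffOn (𝓡 n) 𝓘(ℝ, ℝ) 2 v {SphereSymmetry.north n}ᶜ)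
    (hv_pos : ∀ θ : SphereSymmetry.Sph n, θ ≠ SphereSymmetry.north n → 0 < v θ)
    (hv_eq : ∀ θ : SphereSymmetry.Sph n, θ ≠ SphereSymmetry.north n →
      -SphereSymmetry.conformalLaplacian v θ = g θ (v θ))
    (hv_liminf : 0 < liminf (fun θ => ((v θ : ℝ) : EReal)) (𝓝[≠] SphereSymmetry.north n)) :
    SphereSymmetry.RotationallySymmetric v := by
  open SphereSymmetry in
  set U : EuclideanSpace ℝ (Fin n) → ℝ := fun y => confExtension v (stereo y) with hUdef
  obtain ⟨c, hc, hcv⟩ := exists_pos_le_of_liminf hv_smooth.continuousOn hv_pos hv_liminf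
  have hquad : ∀ y : EuclideanSpace ℝ (Fin n),
      ContDiffAt ℝ 2 U y ∧ (Δ U) y = (Δ (confExtension v)) (stereo y) := by
    intro y
    -- With `m = 0` the quadratic map is `stereo` itself.
    have h := laplacian_comp_quadratic (confExtension_smul v) (e := (0 : EuclideanSpace ℝ (Fin n)))
      (τ := 0) (m := 0) (y := y) (Or.inl rfl)
      (by
        simpa using contDiffAt_confExtension hv_smooth (stereo_ne_zero y) (proj_stereo_ne_north y))
    simpa only [smul_zero, add_zero] using h
  have hU : ContDiff ℝ 2 U := contDiff_iff_contDiffAt.mpr fun y => (hquad y).1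
  have hUpos : ∀ y, 0 < U y := fun y => by
    have := hv_pos _ (proj_stereo_ne_north y)
    simp only [hUdef, confExtension_stereo]
    positivity
  have hUlow : ∀ y, c * ((‖y‖ ^ 2 + 1) / 2) ^ weight n ≤ U y := fun y => by
    have := hcv _ (proj_stereo_ne_north y)
    simp only [hUdef, confExtension_stereo]
    rw [mul_comm]
    gcongr
  have hS : ∀ e : EuclideanSpace ℝ (Fin n), ‖e‖ = 1 → ∀ t, 0 < t → SuperharmonicDiff U e t := by
    intro e he t ht y hy
    have hκ := (one_lt_ratioSq_iff he ht).mpr hy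
    have hκ0 : 0 < ratioSq e t y := by linarith
    have hev : (fun y => confExtension v (stereoInv e t y)) =ᶠ[𝓝 y] fun y => kelvin U e t y := by
      filter_upwards [(continuous_ratioSq_right e t).continuousAt.eventually (lt_mem_nhds hκ0)]
        with z hz using confExtension_stereoInv he hz
    have hqN := proj_stereoInv_ne_north he hκ0
    obtain ⟨h1, h2⟩ := laplacian_comp_quadratic (confExtension_smul v) (e := e) (τ := t)
      (y := y) (Or.inr ⟨he, rfl⟩)
      (contDiffAt_confExtension hv_smooth (stereoInv_ne_zero he hκ0) hqN)
    -- The origin, which represents the south pole, lies on every sphere of the family, so it is not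
    -- an exterior point. This keeps the image off the south pole and makes the height comparison
    -- strict.
    have hy0 : 0 < ‖y‖ ^ 2 := by
      have : y ≠ 0 := by
        rintro rfl
        simp [powerFn] at hy
      positivity
    refine ⟨h1.congr_of_eventuallyEq hev.symm, fun hle => ?_⟩
    have h2' : (Δ (fun y => kelvin U e t y)) y = (Δ (confExtension v)) (stereoInv e t y) :=
      (InnerProductSpace.laplacian_congr_nhds hev).eq_of_nhds.symm.trans h2
    rw [(hquad y).2, h2']
    refine laplacian_confExtension_lt hn g1 g2 g3 g4 hv_smooth hv_pos hv_eq (stereo_ne_zero y)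
      (stereoInv_ne_zero he hκ0) (proj_stereo_ne_north y) hqN ?_ ?_ ?_ ?_
    · intro h
      have h3 := congrArg height h
      rw [height_proj_stereoInv he hκ0, height_south, div_eq_iff (by positivity)] at h3
      linarith
    · rw [height_proj_stereoInv he hκ0, height_proj_stereo, div_lt_div_iff₀ (by positivity)
        (by positivity)]
      nlinarith
    · rw [norm_stereo, norm_stereoInv he]
      linarith
    · rwa [confExtension_stereoInv he hκ0]
  intro R hR θ hθ
  have hθ' : isometryAct R θ ≠ north n := by
    intro h
    have h1 := height_isometryAct hR θ
    rw [h, height_north] at h1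
    exact (height_lt_one hθ).ne h1.symm
  obtain ⟨y, hy⟩ := exists_smul_stereo hθ
  obtain ⟨z, hz⟩ := exists_smul_stereo hθ'
  have hhyz : (‖z‖ ^ 2 - 1) / (‖z‖ ^ 2 + 1) = (‖y‖ ^ 2 - 1) / (‖y‖ ^ 2 + 1) := by
    rw [← height_proj_stereo, ← height_proj_stereo, hy, hz, height_isometryAct hR]
  rw [div_eq_div_iff (by positivity) (by positivity)] at hhyz
  have hyz2 : ‖z‖ ^ 2 = ‖y‖ ^ 2 := by linarith
  have hyz : ‖z‖ = ‖y‖ := (sq_eq_sq₀ (norm_nonneg _) (norm_nonneg _)).mp hyz2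
  have h := eq_of_norm_eq_of_superharmonicDiff hn hU hUpos hc hUlow hS hyz
  -- Equal norms give equal conformal factors, so equality of `U` is equality of `v`.
  simp only [hUdef, confExtension_stereo, hy, hz, hyz] at h
  exact mul_left_cancel₀ (by positivity) h
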